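/- Let $d\in\{2,3\}$ and let $\Omega\subset\mathbb{R}^d$ be a bounded open set with Lipschitz boundary. Write $A\cdot B=\sum_{i,j}A_{ij}B_{ij}$ and $|A|^2=A\cdot A$ for tensors, and $\boldsymbol D\boldsymbol v=\frac12(\nabla\boldsymbol v+(\nabla\boldsymbol v)^{\rm T})$. **Constitutive laws.** For $K\subseteq\mathbb{R}$ we say that $(\boldsymbol S,\boldsymbol q_c,r)$ is *admissible on $K$* if $r:K\to\mathbb{R}$ is Hölder continuous with $1<r^-\le r(\xi)\le r^+<\infty$; $\boldsymbol S:K\times\mathbb{R}^{d\times d}_{\rm sym}\to\mathbb{R}^{d\times d}_{\rm sym}$ is continuous and, for some constants $C_1,C_2,C_3>0$ and all $\xi\in K$ and symmetric $\boldsymbol B,\boldsymbol B_1\ne\boldsymbol B_2$, $$|\boldsymbol S(\xi,\boldsymbol B)|\le C_1(|\boldsymbol B|^{r(\xi)-1}+1),\qquad(\boldsymbol S(\xi,\boldsymbol B_1)-\boldsymbol S(\xi,\boldsymbol B_2))\cdot(\boldsymbol B_1-\boldsymbol B_2)>0,$$ $$\boldsymbol S(\xi,\boldsymbol B)\cdot\boldsymbol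 B\ge C_2\bigl(|\boldsymbol B|^{r(\xi)}+|\boldsymbol S(\xi,\boldsymbol B)|^{r'(\xi)}\bigr)-C_3,\qquad r'=\tfrac{r}{r-1};$$ and $\boldsymbol q_c:K\times\mathbb{R}^d\times\mathbb{R}^{d\times d}_{\rm sym}\to\mathbb{R}^d$ is continuous, linear in its second argument, with $|\boldsymbol q_c(\xi,\boldsymbol g,\boldsymbol B)|\le C_4|\boldsymbol g|$ and $\boldsymbol q_c(\xi,\boldsymbol g,\boldsymbol B)\cdot\boldsymbol g\ge C_5|\boldsymbol g|^2$ for some constants $C_4,C_5>0$. Assume that $(\boldsymbol S,\boldsymbol q_c,r)$ is admissible on $[0,\infty)$. Let $\boldsymbol f\in(W^{1,r^-}_0(\Omega)^d)^*$, and let $c_d\in W^{1,q}(\Omega)$ for some $q>d$, with $c_d\ge0$ a.e. in $\Omega$. **Finite element spaces.** For $n\in\mathbb{N}$ let $\mathcal G_n$ be a finite partition of $\overline\Omega$ into closed nondegenerate simplices $E$ with pairwise disjoint interiors, with nonsingular affine maps $\boldsymbol F_E$ from $E$ onto the reference simplex $\hat E$. Let $\hat{\mathbb P}_{\mathbb V}\subset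 W^{1,\infty}(\hat E)^d$, $\hat{\mathbb P}_{\mathbb Q}\subset L^\infty(\hat E)$, $\hat{\mathbb P}_{\mathbb Z}\subset W^{1,\infty}(\hat E)$ be finite-dimensional subspaces and put $$\mathbb V^n=\{\boldsymbol V\in C(\overline\Omega)^d:\boldsymbol V|_E\circ\boldsymbol F_E^{-1}\in\hat{\mathbb P}_{\mathbb V}\ \forall E\in\mathcal G_n,\ \boldsymbol V|_{\partial\Omega}=0\},\qquad \mathbb Q^n=\{Q\in L^\infty(\Omega):Q|_E\circ\boldsymbol F_E^{-1}\in\hat{\mathbb P}_{\mathbb Q}\ \forall E\in\mathcal G_n\},$$ $$\mathbb Z^n=\{Z\in C(\overline\Omega):Z|_E\circ\boldsymbol F_E^{-1}\in\hat{\mathbb P}_{\mathbb Z}\ \forall E\in\mathcal G_n,\ Z|_{\partial\Omega}=0\},$$ $\mathbb V^n_{\rm div}=\{\boldsymbol V\in\mathbb V^n:\int_\Omega Q\,{\rm div}\boldsymbol V\,dx=0\ \forall Q\in\mathbb Q^n\}$ and $\mathbb Q^n_0=\{Q\in\mathbb Q^n:\int_\Omega Q\,dx=0\}$. Assume that $\mathbb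 Q^n$ contains the piecewise constant functions on $\mathcal G_n$. With $(\boldsymbol a\otimes\boldsymbol b)_{ij}=a_ib_j$ and $(\nabla\boldsymbol v)_{ij}=\partial_iv_j$ let $$B_u[\boldsymbol v,\boldsymbol w,\boldsymbol h]=\tfrac12\int_\Omega\bigl((\boldsymbol v\otimes\boldsymbol h)\cdot\nabla\boldsymbol w-(\boldsymbol v\otimes\boldsymbol w)\cdot\nabla\boldsymbol h\bigr)dx,\qquad B_c[b,\boldsymbol v,z]=\tfrac12\int_\Omega\bigl(z\boldsymbol v\cdot\nabla b-b\boldsymbol v\cdot\nabla z\bigr)dx .$$ **Discrete problems.** Problem $(P_n)$: find $(\boldsymbol U,C)\in\mathbb V^n_{\rm div}\times(\mathbb Z^n+c_d)$ with $$\int_\Omega\boldsymbol S(C,\boldsymbol D\boldsymbol U)\cdot\boldsymbol D\boldsymbol V\,dx+B_u[\boldsymbol U,\boldsymbol U,\boldsymbol V]=\langle\boldsymbol f,\boldsymbol V\rangle\quad\forall\boldsymbol V\in\mathbb V^n_{\rm div},$$ $$\int_\Omega\boldsymbol q_c(C,\nabla C,\boldsymbol D\boldsymbol U)\cdot\nabla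 Z\,dx+B_c[C,\boldsymbol U,Z]=0\quad\forall Z\in\mathbb Z^n.$$ Problem $(Q_n)$: find $(\boldsymbol U,P,C)\in\mathbb V^n\times\mathbb Q^n_0\times(\mathbb Z^n+c_d)$ with $$\int_\Omega\boldsymbol S(C,\boldsymbol D\boldsymbol U)\cdot\boldsymbol D\boldsymbol V\,dx+B_u[\boldsymbol U,\boldsymbol U,\boldsymbol V]-\int_\Omega P\,{\rm div}\boldsymbol V\,dx=\langle\boldsymbol f,\boldsymbol V\rangle\quad\forall\boldsymbol V\in\mathbb V^n,$$ $$\int_\Omega Q\,{\rm div}\boldsymbol U\,dx=0\quad\forall Q\in\mathbb Q^n,\qquad \int_\Omega\boldsymbol q_c(C,\nabla C,\boldsymbol D\boldsymbol U)\cdot\nabla Z\,dx+B_c[C,\boldsymbol U,Z]=0\quad\forall Z\in\mathbb Z^n.$$ Since a discrete concentration may take negative values, $\boldsymbol S$ and $\boldsymbol q_c$ are evaluated there by the constant extension $\boldsymbol S(\xi,\cdot):=\boldsymbol S(0,\cdot)$, $\boldsymbol q_c(\xi,\cdot,\cdot):=\boldsymbol q_c(0,\cdot,\cdot)$ for $\xi<0$.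 **Claim.** For every $n\in\mathbb N$, problem $(P_n)$ has a solution $(\boldsymbol U^n,C^n)$, and for every solution $(\boldsymbol U^n,C^n)$ of $(P_n)$ there is $P^n\in\mathbb Q^n_0$ such that $(\boldsymbol U^n,P^n,C^n)$ solves $(Q_n)$; in particular $(Q_n)$ has a solution. The same holds without the constant extension if $(\boldsymbol S,\boldsymbol q_c,r)$ is given and admissible (with the same $r^\pm$) on all of $\mathbb R$. -/

import Mathlib

open MeasureTheory

open scoped ENNReal ContDiff

noncomputable section

/-- The space `ℝ^d` with its Euclidean norm. -/
abbrev Vec (d : ℕ) : Type := EuclideanSpace ℝ (Fin d)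

/-- Real `d × d` tensors. -/
abbrev Ten (d : ℕ) : Type := Matrix (Fin d) (Fin d) ℝ

/-- Scalar product of two tensors. -/
def tdot {d : ℕ} (A B : Ten d) : ℝ := ∑ i, ∑ j, A i j * B i j

/-- Frobenius norm of a tensor. -/
def tnorm {d : ℕ} (A : Ten d) : ℝ := Real.sqrt (tdot A A)

/-- Tensor product of two vectors. -/
def tenProd {d : ℕ} (a b : Vec d) : Ten d := fun i j => a i * b j

/-! ### Domains and Sobolev spaces -/

/-- Lipschitz boundary: near every boundary point `Ω` is the strict epigraph, in some direction `e`,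
of a Lipschitz function that depends only on the variables orthogonal to `e`. -/
def HasLipschitzBoundary {d : ℕ} (Ω : Set (Vec d)) : Prop :=
  ∀ x₀ ∈ frontier Ω, ∃ e : Vec d, ‖e‖ = 1 ∧
    ∃ (K : NNReal) (γ : Vec d → ℝ), LipschitzWith K γ ∧ (∀ (x : Vec d) (t : ℝ), γ (x + t • e) = γ x) ∧
      ∃ ρ : ℝ, 0 < ρ ∧ ∀ x ∈ Metric.ball x₀ ρ, (x ∈ Ω ↔ γ x < inner ℝ e x)

/-- `g` is the weak gradient of the scalar function `u` in `Ω`. -/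
def HasWeakGrad {d : ℕ} (Ω : Set (Vec d)) (u : Vec d → ℝ) (g : Vec d → Vec d) : Prop :=
  LocallyIntegrableOn u Ω ∧ LocallyIntegrableOn g Ω ∧
    ∀ φ : Vec d → ℝ, ContDiff ℝ ∞ φ → HasCompactSupport φ → tsupport φ ⊆ Ω →
      ∀ i : Fin d, (∫ x in Ω, u x * fderiv ℝ φ x (EuclideanSpace.single i 1))
        = - ∫ x in Ω, g x i * φ x

open Classical in
/-- The weak gradient `∇u` in `Ω`; it is unique up to a null set. -/
def weakGrad {d : ℕ} (Ω : Set (Vec d)) (u : Vec d → ℝ) : Vec d → Vec d :=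
  if h : ∃ g, HasWeakGrad Ω u g then h.choose else 0

/-- `u ∈ W^{1,p}(Ω)`. -/
def MemW1 {d : ℕ} (p : ℝ≥0∞) (Ω : Set (Vec d)) (u : Vec d → ℝ) : Prop :=
  MemLp u p (volume.restrict Ω) ∧ (∃ g, HasWeakGrad Ω u g) ∧
    MemLp (weakGrad Ω u) p (volume.restrict Ω)

/-- `u ∈ W^{1,p}_0(Ω)`, i.e. `u ∈ W^{1,p}(Ω)` and `u = 0` on `∂Ω`, for a bounded Lipschitz domain `Ω`.
The vanishing of the trace is expressed through Green's formula
`∫_Ω u ∂ᵢφ + ∫_Ω φ ∂ᵢu = ∫_∂Ω u φ νᵢ`: the boundary term is zero for every smooth `φ` on `ℝ^d`. -/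
def MemW10 {d : ℕ} (p : ℝ≥0∞) (Ω : Set (Vec d)) (u : Vec d → ℝ) : Prop :=
  MemW1 p Ω u ∧
    ∀ φ : Vec d → ℝ, ContDiff ℝ ∞ φ → HasCompactSupport φ →
      ∀ i : Fin d, (∫ x in Ω, u x * fderiv ℝ φ x (EuclideanSpace.single i 1))
        = - ∫ x in Ω, weakGrad Ω u x i * φ x

/-- `v ∈ W^{1,p}_0(Ω)^d`, componentwise. -/
def MemW10Vec {d : ℕ} (p : ℝ≥0∞) (Ω : Set (Vec d)) (v : Vec d → Vec d) : Prop :=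
  ∀ i : Fin d, MemW10 p Ω (fun x => v x i)

/-- The norm of `W^{1,p}(Ω)^d`, up to equivalence of norms. -/
def normW1Vec {d : ℕ} (p : ℝ≥0∞) (Ω : Set (Vec d)) (v : Vec d → Vec d) : ℝ :=
  ∑ i : Fin d, ((eLpNorm (fun x => v x i) p (volume.restrict Ω)).toReal
    + (eLpNorm (weakGrad Ω (fun x => v x i)) p (volume.restrict Ω)).toReal)

/-- `f ∈ (W^{1,p}_0(Ω)^d)^*`: a bounded linear functional on `W^{1,p}_0(Ω)^d`. The values of `f` on
other functions play no role; boundedness makes `f` depend only on almost everywhere classes. -/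
def IsDualW10Vec {d : ℕ} (p : ℝ≥0∞) (Ω : Set (Vec d)) (f : (Vec d → Vec d) → ℝ) : Prop :=
  (∀ v w, MemW10Vec p Ω v → MemW10Vec p Ω w → f (v + w) = f v + f w) ∧
  (∀ (a : ℝ) (v), MemW10Vec p Ω v → f (a • v) = a * f v) ∧
  ∃ M : ℝ, ∀ v, MemW10Vec p Ω v → |f v| ≤ M * normW1Vec p Ω v

/-- The velocity gradient, `(∇v)ᵢⱼ = ∂ᵢ vⱼ`. -/
def gradT {d : ℕ} (Ω : Set (Vec d)) (v : Vec d → Vec d) (x : Vec d) : Ten d :=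
  fun i j => weakGrad Ω (fun y => v y j) x i

/-- The symmetric velocity gradient `Dv = (∇v + (∇v)ᵀ)/2`. -/
def symGrad {d : ℕ} (Ω : Set (Vec d)) (v : Vec d → Vec d) (x : Vec d) : Ten d :=
  (1 / 2 : ℝ) • (gradT Ω v x + (gradT Ω v x).transpose)

/-- The divergence of a vector field. -/
def divW {d : ℕ} (Ω : Set (Vec d)) (v : Vec d → Vec d) (x : Vec d) : ℝ :=
  ∑ i, gradT Ω v x i i

/-! ### Constitutive laws -/

/-- The structural conditions on the extra stress `S(ξ,B)`, the flux `q(ξ,g,B)` and the exponent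
`r(ξ)`, for concentrations `ξ` in the set `K` and symmetric tensors `B`. -/
structure ConstitutiveLaws {d : ℕ} (K : Set ℝ) (S : ℝ → Ten d → Ten d)
    (q : ℝ → Vec d → Ten d → Vec d) (r : ℝ → ℝ) (rm rp : ℝ) : Prop where
  one_lt : 1 < rm
  bounds : ∀ ξ ∈ K, rm ≤ r ξ ∧ r ξ ≤ rp
  holder : ∃ C α : NNReal, 0 < α ∧ α ≤ 1 ∧ HolderOnWith C α r K
  stress_symm : ∀ ξ ∈ K, ∀ B : Ten d, B.IsSymm → (S ξ B).IsSymm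
  stress_cont : ContinuousOn (fun z : ℝ × Ten d => S z.1 z.2) (K ×ˢ {B | B.IsSymm})
  stress_growth : ∃ C₁ : ℝ, 0 < C₁ ∧ ∀ ξ ∈ K, ∀ B : Ten d, B.IsSymm →
    tnorm (S ξ B) ≤ C₁ * (tnorm B ^ (r ξ - 1) + 1)
  stress_mono : ∀ ξ ∈ K, ∀ B₁ B₂ : Ten d, B₁.IsSymm → B₂.IsSymm → B₁ ≠ B₂ →
    0 < tdot (S ξ B₁ - S ξ B₂) (B₁ - B₂)
  stress_coercive : ∃ C₂ C₃ : ℝ, 0 < C₂ ∧ 0 < C₃ ∧ ∀ ξ ∈ K, ∀ B : Ten d, B.IsSymm →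
    C₂ * (tnorm B ^ r ξ + tnorm (S ξ B) ^ (r ξ / (r ξ - 1))) - C₃ ≤ tdot (S ξ B) B
  flux_cont : ContinuousOn (fun z : ℝ × Vec d × Ten d => q z.1 z.2.1 z.2.2)
    (K ×ˢ Set.univ ×ˢ {B | B.IsSymm})
  flux_linear : ∀ ξ ∈ K, ∀ B : Ten d, B.IsSymm → IsLinearMap ℝ (fun g => q ξ g B)
  flux_growth : ∃ C₄ : ℝ, 0 < C₄ ∧ ∀ ξ ∈ K, ∀ g : Vec d, ∀ B : Ten d, B.IsSymm →
    ‖q ξ g B‖ ≤ C₄ * ‖g‖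
  flux_coercive : ∃ C₅ : ℝ, 0 < C₅ ∧ ∀ ξ ∈ K, ∀ g : Vec d, ∀ B : Ten d, B.IsSymm →
    C₅ * ‖g‖ ^ 2 ≤ inner ℝ (q ξ g B) g

/-! ### Meshes and finite element spaces -/

/-- The closed reference simplex of `ℝ^d`. -/
def refSimplex (d : ℕ) : Set (Vec d) := {x | (∀ i, 0 ≤ x i) ∧ ∑ i, x i ≤ 1}

/-- A finite partition of `closure Ω` into closed simplices, each given by the nonsingular affine
map that takes it onto the reference simplex. -/
structure Mesh {d : ℕ} (Ω : Set (Vec d)) where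
  card : ℕ
  F : Fin card → (Vec d ≃ᵃ[ℝ] Vec d)
  cover : ⋃ k, (F k).symm '' refSimplex d = closure Ω
  disjoint : Pairwise fun k l =>
    Disjoint (interior ((F k).symm '' refSimplex d)) (interior ((F l).symm '' refSimplex d))

/-- The closed simplex with index `k`. -/
def Mesh.elem {d : ℕ} {Ω : Set (Vec d)} (G : Mesh Ω) (k : Fin G.card) : Set (Vec d) :=
  (G.F k).symm '' refSimplex d

/-- The finite-dimensional spaces on the reference simplex. `W^{1,∞}` of the (convex) reference
simplex is the space of Lipschitz functions on it. -/
structure RefSpaces (d : ℕ) where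
  V : Submodule ℝ (refSimplex d → Vec d)
  Q : Submodule ℝ (Lp ℝ ∞ (volume.restrict (refSimplex d)))
  Z : Submodule ℝ (refSimplex d → ℝ)
  V_fin : FiniteDimensional ℝ V
  Q_fin : FiniteDimensional ℝ Q
  Z_fin : FiniteDimensional ℝ Z
  V_lip : ∀ v ∈ V, ∃ K : NNReal, LipschitzWith K v
  Z_lip : ∀ z ∈ Z, ∃ K : NNReal, LipschitzWith K z

variable {d : ℕ} {Ω : Set (Vec d)}

/-- The velocity space: continuous, zero on `∂Ω`, and in the reference space on each element.
Such functions are identified with their extensions by zero to `ℝ^d`. -/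
def velSpace (R : RefSpaces d) (G : Mesh Ω) : Submodule ℝ (Vec d → Vec d) where
  carrier := {v | Continuous v ∧ (∀ x, x ∉ Ω → v x = 0) ∧
    ∀ k, (fun y : refSimplex d => v ((G.F k).symm y)) ∈ R.V}
  add_mem' := by
    rintro a b ⟨h1, h2, h3⟩ ⟨g1, g2, g3⟩
    exact ⟨h1.add g1, fun x hx => by simp [h2 x hx, g2 x hx], fun k => R.V.add_mem (h3 k) (g3 k)⟩
  zero_mem' := ⟨continuous_const, fun _ _ => rfl, fun _ => R.V.zero_mem⟩
  smul_mem' := by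
    rintro c a ⟨h1, h2, h3⟩
    exact ⟨h1.const_smul c, fun x hx => by simp [h2 x hx], fun k => R.V.smul_mem c (h3 k)⟩

/-- The concentration space: continuous, zero on `∂Ω`, and in the reference space on each element.
Such functions are identified with their extensions by zero to `ℝ^d`. -/
def concSpace (R : RefSpaces d) (G : Mesh Ω) : Submodule ℝ (Vec d → ℝ) where
  carrier := {z | Continuous z ∧ (∀ x, x ∉ Ω → z x = 0) ∧
    ∀ k, (fun y : refSimplex d => z ((G.F k).symm y)) ∈ R.Z}
  add_mem' := by
    rintro a b ⟨h1, h2, h3⟩ ⟨g1, g2, g3⟩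
    exact ⟨h1.add g1, fun x hx => by simp [h2 x hx, g2 x hx], fun k => R.Z.add_mem (h3 k) (g3 k)⟩
  zero_mem' := ⟨continuous_const, fun _ _ => rfl, fun _ => R.Z.zero_mem⟩
  smul_mem' := by
    rintro c a ⟨h1, h2, h3⟩
    exact ⟨h1.const_smul c, fun x hx => by simp [h2 x hx], fun k => R.Z.smul_mem c (h3 k)⟩

/-- Restriction of a statement about almost every point of `Ω` to one of its subsets. -/
theorem ae_elem_of_ae {A : Set (Vec d)} {p : Vec d → Prop} (h : ∀ᵐ x ∂volume.restrict Ω, p x) :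
    ∀ᵐ x ∂volume.restrict (A ∩ Ω), p x :=
  ae_mono (Measure.restrict_mono Set.inter_subset_right le_rfl) h

/-- Almost everywhere statements on the reference simplex, pulled back to an element. -/
theorem ae_pullback (F : Vec d ≃ᵃ[ℝ] Vec d) {p : Vec d → Prop}
    (h : ∀ᵐ y ∂volume.restrict (refSimplex d), p y) :
    ∀ᵐ x ∂volume.restrict ((F.symm '' refSimplex d) ∩ Ω), p (F x) := by
  have hc : IsClosed (refSimplex d) := by
    have h1 : refSimplex d = (⋂ i, {x : Vec d | 0 ≤ x i}) ∩ {x : Vec d | ∑ i, x i ≤ 1} := by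
      ext x
      simp [refSimplex]
    rw [h1]
    refine (isClosed_iInter fun i => isClosed_le (by fun_prop) (by fun_prop)).inter
      (isClosed_le (by fun_prop) (by fun_prop))
  have hd : Differentiable ℝ (F.symm : Vec d → Vec d) :=
    ContinuousAffineMap.differentiable (𝕜 := ℝ)
      (f := { (F.symm : Vec d →ᵃ[ℝ] Vec d) with
        cont := AffineMap.continuous_of_finiteDimensional (F.symm : Vec d →ᵃ[ℝ] Vec d) })
  have hm : MeasurableSet (F.symm '' refSimplex d) := by
    have h2 : F.symm '' refSimplex d = F ⁻¹' refSimplex d := by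
      ext x
      constructor
      · rintro ⟨y, hy, rfl⟩
        simpa using hy
      · intro hx
        exact ⟨F x, hx, by simp⟩
    rw [h2]
    exact (hc.preimage (AffineMap.continuous_of_finiteDimensional
      (F : Vec d →ᵃ[ℝ] Vec d))).measurableSet
  refine ae_mono (Measure.restrict_mono Set.inter_subset_left le_rfl) ?_
  refine (ae_restrict_iff' hm).2 ?_
  rw [ae_restrict_iff' hc.measurableSet, ae_iff] at h
  have h3 := addHaar_image_eq_zero_of_differentiableOn_of_addHaar_eq_zero volume
    (hd.differentiableOn (s := {y | ¬(y ∈ refSimplex d → p y)})) h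
  rw [ae_iff]
  refine measure_mono_null ?_ h3
  intro x hx
  simp only [Set.mem_ofPred_eq, Classical.not_imp] at hx
  obtain ⟨⟨y, hy, rfl⟩, hx2⟩ := hx
  refine ⟨y, ?_, rfl⟩
  simpa [hy] using hx2

/-- The pressure space: bounded, and in the reference space on each element. -/
def presSpace (R : RefSpaces d) (G : Mesh Ω) : Submodule ℝ (Lp ℝ ∞ (volume.restrict Ω)) where
  carrier := {P | ∀ k, ∃ p ∈ R.Q, ∀ᵐ x ∂volume.restrict (G.elem k ∩ Ω), P x = p (G.F k x)}
  add_mem' := by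
    intro a b ha hb k
    obtain ⟨p, hp, hpa⟩ := ha k
    obtain ⟨s, hs, hsb⟩ := hb k
    refine ⟨p + s, R.Q.add_mem hp hs, ?_⟩
    filter_upwards [hpa, hsb, ae_elem_of_ae (A := G.elem k) (Lp.coeFn_add a b),
      ae_pullback (G.F k) (Lp.coeFn_add p s)] with x h1 h2 h3 h4
    rw [h3, h4, Pi.add_apply, Pi.add_apply, h1, h2]
  zero_mem' := by
    intro k
    refine ⟨0, R.Q.zero_mem, ?_⟩
    filter_upwards [ae_elem_of_ae (A := G.elem k) (Lp.coeFn_zero ℝ ∞ (volume.restrict Ω)),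
      ae_pullback (G.F k) (Lp.coeFn_zero ℝ ∞ (volume.restrict (refSimplex d)))] with x h3 h4
    rw [h3, h4, Pi.zero_apply, Pi.zero_apply]
  smul_mem' := by
    intro c a ha k
    obtain ⟨p, hp, hpa⟩ := ha k
    refine ⟨c • p, R.Q.smul_mem c hp, ?_⟩
    filter_upwards [hpa, ae_elem_of_ae (A := G.elem k) (Lp.coeFn_smul c a),
      ae_pullback (G.F k) (Lp.coeFn_smul c p)] with x h1 h3 h4
    rw [h3, h4, Pi.smul_apply, Pi.smul_apply, h1]

/-- The pressure space contains all piecewise constant functions. -/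
def ContainsPiecewiseConst (R : RefSpaces d) (G : Mesh Ω) : Prop :=
  ∀ P : Lp ℝ ∞ (volume.restrict Ω),
    (∀ k, ∃ a : ℝ, ∀ᵐ x ∂volume.restrict (G.elem k ∩ Ω), P x = a) → P ∈ presSpace R G

/-- Discretely divergence-free velocities. -/
def velDivSpace (R : RefSpaces d) (G : Mesh Ω) : Set (Vec d → Vec d) :=
  {v | v ∈ velSpace R G ∧ ∀ P ∈ presSpace R G, ∫ x in Ω, divW Ω v x * P x = 0}

/-- Discrete pressures with zero integral mean. -/
def presZeroSpace (R : RefSpaces d) (G : Mesh Ω) : Set (Lp ℝ ∞ (volume.restrict Ω)) :=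
  {P | P ∈ presSpace R G ∧ ∫ x in Ω, P x = 0}

/-! ### The discrete problems -/

/-- The skew-symmetric trilinear form of the momentum equation. -/
def formBu (Ω : Set (Vec d)) (v w h : Vec d → Vec d) : ℝ :=
  (1 / 2) * ∫ x in Ω, (tdot (tenProd (v x) (h x)) (gradT Ω w x)
    - tdot (tenProd (v x) (w x)) (gradT Ω h x))

/-- The skew-symmetric trilinear form of the concentration equation. -/
def formBc (Ω : Set (Vec d)) (b : Vec d → ℝ) (v : Vec d → Vec d) (z : Vec d → ℝ) : ℝ :=
  (1 / 2) * ∫ x in Ω, (z x * inner ℝ (v x) (weakGrad Ω b x)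
    - b x * inner ℝ (v x) (weakGrad Ω z x))

/-- The discrete concentration equation, tested with `Z`. -/
def ConcEq (Ω : Set (Vec d)) (q : ℝ → Vec d → Ten d → Vec d)
    (U : Vec d → Vec d) (C Z : Vec d → ℝ) : Prop :=
  (∫ x in Ω, inner ℝ (q (C x) (weakGrad Ω C x) (symGrad Ω U x)) (weakGrad Ω Z x))
    + formBc Ω C U Z = 0

/-- `(U, C)` solves the Galerkin problem over discretely divergence-free velocities. -/
def SolvesDivFree (R : RefSpaces d) (G : Mesh Ω) (S : ℝ → Ten d → Ten d)
    (q : ℝ → Vec d → Ten d → Vec d) (f : (Vec d → Vec d) → ℝ) (c_d : Vec d → ℝ)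
    (U : Vec d → Vec d) (C : Vec d → ℝ) : Prop :=
  U ∈ velDivSpace R G ∧ C - c_d ∈ concSpace R G ∧
  (∀ V ∈ velDivSpace R G,
    (∫ x in Ω, tdot (S (C x) (symGrad Ω U x)) (symGrad Ω V x)) + formBu Ω U U V = f V) ∧
  ∀ Z ∈ concSpace R G, ConcEq Ω q U C Z

/-- `(U, P, C)` solves the finite element problem with pressure. -/
def SolvesMixed (R : RefSpaces d) (G : Mesh Ω) (S : ℝ → Ten d → Ten d)
    (q : ℝ → Vec d → Ten d → Vec d) (f : (Vec d → Vec d) → ℝ) (c_d : Vec d → ℝ)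
    (U : Vec d → Vec d) (P : Lp ℝ ∞ (volume.restrict Ω)) (C : Vec d → ℝ) : Prop :=
  U ∈ velSpace R G ∧ P ∈ presZeroSpace R G ∧ C - c_d ∈ concSpace R G ∧
  (∀ V ∈ velSpace R G,
    (∫ x in Ω, tdot (S (C x) (symGrad Ω U x)) (symGrad Ω V x)) + formBu Ω U U V
      - (∫ x in Ω, divW Ω V x * P x) = f V) ∧
  (∀ Q ∈ presSpace R G, ∫ x in Ω, Q x * divW Ω U x = 0) ∧
  ∀ Z ∈ concSpace R G, ConcEq Ω q U C Z

/-- The divergence-free Galerkin problem has a solution, and every solution of it is completed by a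
discrete pressure to a solution of the finite element problem with pressure. -/
def DiscretelySolvable (R : RefSpaces d) (G : Mesh Ω) (S : ℝ → Ten d → Ten d)
    (q : ℝ → Vec d → Ten d → Vec d) (f : (Vec d → Vec d) → ℝ) (c_d : Vec d → ℝ) : Prop :=
  (∃ U C, SolvesDivFree R G S q f c_d U C) ∧
  ∀ U C, SolvesDivFree R G S q f c_d U C → ∃ P, SolvesMixed R G S q f c_d U P C

end

/-! The discrete problem is finite-dimensional, and it is solved by Brouwer's theorem.

*A zero of an outward pointing vector field.* Brouwer's theorem enters as
`exists_zero_of_inner_pos`. It rests on the absence of `C¹` retractions of a ball onto its boundary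
(`not_exists_contDiff_retraction`): if `f` were one, the integral over the ball of the Jacobian of
`x ↦ x + t (f x - x)` would be a polynomial in `t`, equal to the volume of the ball for small `t` and
to zero for `t = 1`. The two equations are coupled through
`exists_common_zero_of_triangular_coercive`: the momentum equation bounds the velocity independently
of the concentration, so the velocity may be truncated in the concentration equation, which is then
coercive as well.

*Finite element functions.* They are Lipschitz and vanish off `Ω` (`Mesh.exists_lipschitzWith`).
Rademacher's theorem and integration by parts give them weak gradients and place them in `W₀^{1,p}`
(`LipZero.memW10`); the gradient vanishes at almost every zero of the function, so the boundary
contributes nothing. One vanishing partial derivative makes such a function zero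
(`LipZero.eq_zero_of_partial_eq_zero`), which yields discrete Korn and Poincaré inequalities by
equivalence of norms.

*Coercivity.* Tested with the solution itself, the skew-symmetric convective form drops out, and
since `r ≥ rm > 1` the stress power grows faster than any multiple of the load
(`exists_momentum_coercivity`). In the concentration equation the quadratic flux term beats the
contributions of the boundary datum and of the transport term, which are linear for bounded velocity
(`exists_concentration_coercivity`). Continuity of the residuals is dominated convergence, organized
by `DominatedFamily`.

*Pressure.* The momentum residual of a solution vanishes on the kernel of the divergence pairing, so
it lies in the range of that pairing on the finite-dimensional dual of the velocity space. Constants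
are orthogonal to all divergences, so the mean value of the pressure can be subtracted
(`SolvesDivFree.exists_solvesMixed`).

The constant extension to negative concentrations turns admissible laws on `[0, ∞)` into admissible
laws on `ℝ` (`ConstitutiveLaws.comp_max`), so only laws on `ℝ` have to be treated. -/

section FiniteElementSystem

/-! ### Zeros of vector fields that point outwards -/

open Set Metric in
/-- The map `t ↦ det (1 + t A)` is a polynomial of bounded degree, so its value at `t = 1` is a fixed
affine combination of its values at finitely many arbitrarily small times. -/
theorem exists_det_one_add_eq_sum {E : Type*} [NormedAddCommGroup E] [NormedSpace ℝ E]
    [FiniteDimensional ℝ E] {ε : ℝ} (hε : 0 < ε) :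
    ∃ (N : ℕ) (t c : Fin N → ℝ), (∀ j, 0 < t j ∧ t j < ε) ∧ ∑ j, c j = 1 ∧
      ∀ A : E →L[ℝ] E, (1 + A).det = ∑ j, c j * (1 + t j • A).det := by
  classical
  set n := Module.finrank ℝ E
  set b := Module.finBasis ℝ E
  set N := n + 1
  set t : Fin N → ℝ := fun j => ε * ((j : ℝ) + 1) / (N + 1)
  have ht : Function.Injective t := by
    intro i j hij
    have hN : (N : ℝ) + 1 ≠ 0 := by positivity
    simp only [t] at hij
    field_simp at hij
    exact Fin.ext (by exact_mod_cast add_right_cancel hij)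
  set c : Fin N → ℝ := fun j => (Lagrange.basis Finset.univ t j).eval 1
  have key : ∀ A : E →L[ℝ] E, (1 + A).det = ∑ j, c j * (1 + t j • A).det := by
    intro A
    set M := LinearMap.toMatrix b b (A : E →ₗ[ℝ] E)
    set P : Polynomial ℝ :=
      ((Polynomial.X : Polynomial ℝ) • M.map Polynomial.C
        + (1 : Matrix (Fin n) (Fin n) ℝ).map Polynomial.C).det with hP
    have hdeg : P.degree < (Finset.univ : Finset (Fin N)).card := by
      refine lt_of_le_of_lt Polynomial.degree_le_natDegree ?_
      have := Polynomial.natDegree_det_X_add_C_le M 1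
      rw [Fintype.card_fin] at this
      rw [Finset.card_univ, Fintype.card_fin]
      exact_mod_cast Nat.lt_succ_of_le this
    have heval : ∀ s : ℝ, P.eval s = (1 + s • A).det := by
      intro s
      rw [hP, ← Polynomial.coe_evalRingHom, RingHom.map_det]
      have h1 : (Polynomial.evalRingHom s).mapMatrix
          ((Polynomial.X : Polynomial ℝ) • M.map Polynomial.C
            + (1 : Matrix (Fin n) (Fin n) ℝ).map Polynomial.C)
          = LinearMap.toMatrix b b ((1 + s • A : E →L[ℝ] E) : E →ₗ[ℝ] E) := by
        ext i j
        simp [M, LinearMap.toMatrix_apply, Matrix.one_apply, Finsupp.single_apply, add_comm,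
          eq_comm]
        rw [apply_ite (Polynomial.eval s), Polynomial.eval_one, Polynomial.eval_zero, mul_comm s]
      rw [h1, LinearMap.det_toMatrix]
    have := congrArg (Polynomial.eval (1 : ℝ)) (Lagrange.eq_interpolate (ht.injOn) hdeg)
    rw [heval, one_smul, Lagrange.interpolate_apply, Polynomial.eval_finsetSum] at this
    rw [this]
    refine Finset.sum_congr rfl fun j _ => ?_
    rw [Polynomial.eval_mul, Polynomial.eval_C, heval, mul_comm]
  refine ⟨N, t, c, fun j => ⟨by positivity, ?_⟩, ?_, key⟩
  · have hj : (j : ℝ) + 1 ≤ N := by exact_mod_cast j.2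
    simp only [t]
    rw [div_lt_iff₀ (by positivity)]
    nlinarith
  · have h0 := key 0
    simpa [ContinuousLinearMap.det] using h0.symm

open Set Metric in
/-- A map that is Lipschitz on a ball and vanishes on its boundary stays Lipschitz, with the same
constant, when extended by zero. -/
theorem lipschitzWith_indicator_closedBall {E : Type*} [NormedAddCommGroup E] [NormedSpace ℝ E]
    {g : E → E} {R : ℝ} {L : NNReal} (hL : LipschitzOnWith L g (closedBall 0 R))
    (h0 : ∀ x ∈ sphere (0 : E) R, g x = 0) :
    LipschitzWith L ((closedBall 0 R).indicator g) := by
  have aux : ∀ x y : E, x ∈ closedBall (0 : E) R → y ∉ closedBall (0 : E) R →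
      dist (g x) 0 ≤ L * dist x y := by
    intro x y hx hy
    rw [mem_closedBall_zero_iff] at hx hy
    have hcont : ContinuousOn (fun s : ℝ => ‖x + s • (y - x)‖) (Icc 0 1) := by fun_prop
    obtain ⟨s, hs, hsR⟩ := intermediate_value_Icc (zero_le_one) hcont
      (show R ∈ Icc _ _ by simpa using ⟨hx, (not_le.1 hy).le⟩)
    have hz : x + s • (y - x) ∈ sphere (0 : E) R := by simpa using hsR
    rw [← h0 _ hz]
    refine (hL.dist_le_mul _ (by simpa using hx) _ (sphere_subset_closedBall hz)).trans ?_
    gcongr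
    rw [dist_eq_norm, dist_eq_norm]
    have : x - (x + s • (y - x)) = s • (x - y) := by rw [← neg_sub x y, smul_neg]; abel
    rw [this, norm_smul, Real.norm_of_nonneg hs.1]
    exact mul_le_of_le_one_left (norm_nonneg _) hs.2
  refine LipschitzWith.of_dist_le_mul fun x y => ?_
  by_cases hx : x ∈ closedBall (0 : E) R <;> by_cases hy : y ∈ closedBall (0 : E) R
  · rw [indicator_of_mem hx, indicator_of_mem hy]; exact hL.dist_le_mul _ hx _ hy
  · rw [indicator_of_mem hx, indicator_of_notMem hy]; exact aux x y hx hy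
  · rw [indicator_of_notMem hx, indicator_of_mem hy, dist_comm, dist_comm x]; exact aux y x hy hx
  · rw [indicator_of_notMem hx, indicator_of_notMem hy, dist_self]; positivity

open Set Metric in
/-- A small Lipschitz perturbation of the identity that fixes the boundary of a ball maps the ball
bijectively onto itself. -/
theorem bijOn_closedBall_id_add_smul {E : Type*} [NormedAddCommGroup E] [NormedSpace ℝ E]
    [CompleteSpace E] {g : E → E} {R t : ℝ} {L : NNReal}
    (hL : LipschitzOnWith L g (closedBall 0 R)) (h0 : ∀ x ∈ sphere (0 : E) R, g x = 0)
    (ht : 0 ≤ t) (htL : t * L < 1) :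
    BijOn (fun x => x + t • g x) (closedBall 0 R) (closedBall 0 R) := by
  set h : E → E := (closedBall 0 R).indicator g
  have hh := lipschitzWith_indicator_closedBall hL h0
  have hcontr : ∀ y, ContractingWith (⟨t, ht⟩ * L) (fun x => y - t • h x) := by
    intro y
    refine ⟨by exact_mod_cast htL, LipschitzWith.of_dist_le_mul fun a b => ?_⟩
    rw [dist_sub_left, dist_smul₀, Real.norm_of_nonneg ht]
    calc t * dist (h a) (h b) ≤ t * (L * dist a b) := by gcongr; exact hh.dist_le_mul a b
      _ = _ := by rw [← mul_assoc]; rfl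
  have huniq : ∀ a b, a + t • h a = b + t • h b → a = b := by
    intro a b hab
    refine (hcontr (a + t • h a)).fixedPoint_unique' (x := a) (y := b) ?_ ?_
    · simp [Function.IsFixedPt]
    · simp [Function.IsFixedPt, hab]
  have heq : ∀ x ∈ closedBall (0 : E) R, x + t • g x = x + t • h x := fun x hx => by
    simp only [h, indicator_of_mem hx]
  have hex : ∀ y, ∃ x, x + t • h x = y := by
    intro y
    refine ⟨(hcontr y).fixedPoint, ?_⟩
    have := (hcontr y).fixedPoint_isFixedPt
    have h2 : y - t • h (hcontr y).fixedPoint = (hcontr y).fixedPoint := this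
    exact (sub_eq_iff_eq_add.1 h2).symm
  refine ⟨fun x hx => ?_, fun a ha b hb hab => ?_, fun y hy => ?_⟩
  · by_contra hy
    -- a point outside the ball is fixed, so by injectivity it has no second preimage in the ball
    simp only [heq x hx] at hy
    have := huniq x (x + t • h x) (by simp [h, indicator_of_notMem hy])
    exact hy (this ▸ hx)
  · simp only [heq a ha, heq b hb] at hab
    exact huniq a b hab
  · obtain ⟨x, hx⟩ := hex y
    by_cases hxR : x ∈ closedBall (0 : E) R
    · exact ⟨x, hxR, by simpa only [heq x hxR] using hx⟩
    · have : x = y := by simpa [h, indicator_of_notMem hxR] using hx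
      exact absurd (this ▸ hy) hxR

open Set Metric in
/-- There is no `C¹` retraction of a ball onto its boundary. For small `t` the map
`x ↦ x + t (f x - x)` is a bijection of the ball, so the integral of its Jacobian is the volume of the
ball; being polynomial in `t`, this integral has the same value at `t = 1`, where the Jacobian of
`f` vanishes because `f` has values in a sphere. -/
theorem not_exists_contDiff_retraction {E : Type*} [NormedAddCommGroup E] [InnerProductSpace ℝ E]
    [FiniteDimensional ℝ E] {R : ℝ} (hR : 0 < R) {f : E → E} (hf : ContDiff ℝ 1 f)
    (hid : ∀ x ∈ sphere (0 : E) R, f x = x) (hnorm : ∀ x, ‖f x‖ = R) : False := by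
  borelize E
  set B := closedBall (0 : E) R
  set g : E → E := fun x => f x - x
  have hg : ContDiff ℝ 1 g := hf.sub contDiff_id
  have hgd : ∀ x, HasFDerivAt g (fderiv ℝ g x) x := fun x =>
    (hg.differentiable (by simp) x).hasFDerivAt
  have hgc : Continuous (fderiv ℝ g) := hg.continuous_fderiv (by simp)
  have hB : IsCompact B := isCompact_closedBall _ _
  obtain ⟨L, hL⟩ : ∃ L : NNReal, ∀ x ∈ B, ‖fderiv ℝ g x‖₊ ≤ L := by
    obtain ⟨C, hC⟩ := hB.exists_bound_of_continuousOn hgc.continuousOn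
    exact ⟨C.toNNReal, fun x hx => by
      rw [← norm_toNNReal]; exact Real.toNNReal_le_toNNReal (hC x hx)⟩
  have hlip : LipschitzOnWith L g B :=
    (convex_closedBall _ _).lipschitzOnWith_of_nnnorm_hasFDerivWithin_le
      (fun x _ => (hgd x).hasFDerivWithinAt) hL
  have hg0 : ∀ x ∈ sphere (0 : E) R, g x = 0 := fun x hx => by simp [g, hid x hx]
  have hdetc : Continuous (ContinuousLinearMap.det : (E →L[ℝ] E) → ℝ) :=
    ContinuousLinearMap.continuous_det
  -- operators close to the identity have positive determinant
  obtain ⟨δ, hδ, hdet⟩ : ∃ δ > 0, ∀ A : E →L[ℝ] E, ‖A‖ < δ → 0 < (1 + A).det := by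
    have h1 : ContinuousAt (fun A : E →L[ℝ] E => (1 + A).det) 0 :=
      (hdetc.comp (by fun_prop : Continuous fun A : E →L[ℝ] E => 1 + A)).continuousAt
    have h2 : (fun A : E →L[ℝ] E => (1 + A).det) 0 = 1 := by simp [ContinuousLinearMap.det]
    have := h1.eventually (lt_mem_nhds (a := 0) (by rw [h2]; exact one_pos))
    obtain ⟨δ, hδ, h⟩ := Metric.eventually_nhds_iff.1 this
    exact ⟨δ, hδ, fun A hA => h (by simpa using hA)⟩
  -- times below `ε` make `x ↦ x + t g x` bijective on the ball, with positive Jacobian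
  set ε := min 1 δ / (L + 1)
  have hε : 0 < ε := by positivity
  obtain ⟨N, t, c, ht, hc, hsum⟩ := exists_det_one_add_eq_sum (E := E) hε
  have hsmall : ∀ j, t j * L < min 1 δ := by
    intro j
    have h1 : t j * (L + 1) < min 1 δ := (lt_div_iff₀ (by positivity)).1 (ht j).2
    have := (ht j).1
    nlinarith
  have hvol : ∀ j, ∫ x in B, (1 + t j • fderiv ℝ g x).det = (volume B).toReal := by
    intro j
    have hbij := bijOn_closedBall_id_add_smul hlip hg0 (ht j).1.le
      ((hsmall j).trans_le (min_le_left _ _))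
    have hder : ∀ x ∈ B, HasFDerivWithinAt (fun x => x + t j • g x)
        (1 + t j • fderiv ℝ g x) B x := fun x _ =>
      ((hasFDerivAt_id x).add ((hgd x).const_smul (t j))).hasFDerivWithinAt
    have := integral_image_eq_integral_abs_det_fderiv_smul volume hB.measurableSet hder
      hbij.injOn (fun _ => (1 : ℝ))
    rw [hbij.image_eq] at this
    simp only [smul_eq_mul, mul_one, integral_const, Measure.real, Measure.restrict_apply_univ]
      at this
    rw [this]
    refine setIntegral_congr_fun hB.measurableSet fun x hx => ?_
    refine (abs_of_pos (hdet _ ?_)).symm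
    rw [norm_smul, Real.norm_of_nonneg (ht j).1.le]
    refine lt_of_le_of_lt ?_ ((hsmall j).trans_le (min_le_right _ _))
    exact mul_le_mul_of_nonneg_left (by exact_mod_cast hL x hx) (ht j).1.le
  have hzero : ∀ x, (1 + fderiv ℝ g x).det = 0 := by
    intro x
    have hfd : HasFDerivAt f (1 + fderiv ℝ g x) x := by
      have := (hasFDerivAt_id x).add (hgd x)
      convert this using 1
      · ext y; simp [g]
      · rfl
    have hconst : HasFDerivAt (fun y => ‖f y‖ ^ 2) (0 : E →L[ℝ] ℝ) x := by
      simp only [hnorm]; exact hasFDerivAt_const _ _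
    have horth : ∀ v, inner ℝ (f x) ((1 + fderiv ℝ g x) v) = 0 := by
      intro v
      have := congrArg (fun T : E →L[ℝ] ℝ => T v) (hconst.unique hfd.norm_sq)
      simpa [← mul_add, ← inner_add_right] using this.symm
    by_contra hne
    obtain ⟨v, hv⟩ := (LinearMap.equivOfDetNeZero _ hne).surjective (f x)
    have h3 := horth v
    rw [show (1 + fderiv ℝ g x) v = f x from hv, real_inner_self_eq_norm_sq, hnorm] at h3
    exact hR.ne' (by simpa using h3)
  have hpos : 0 < (volume B).toReal :=
    ENNReal.toReal_pos (measure_closedBall_pos _ _ hR).ne' hB.measure_lt_top.ne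
  have hfin : ∫ x in B, (1 + fderiv ℝ g x).det = (volume B).toReal := by
    rw [integral_congr_ae (Filter.Eventually.of_forall fun x => hsum (fderiv ℝ g x)),
      integral_finsetSum]
    · simp_rw [integral_const_mul, hvol, ← Finset.sum_mul, hc, one_mul]
    · intro j _
      exact (continuous_const.mul (hdetc.comp (by fun_prop))).continuousOn.integrableOn_compact hB
  simp [hzero] at hfin
  linarith

open Set Metric in
/-- A continuous vector field on a finite-dimensional Euclidean space that points outwards outside a
ball has a zero (an equivalent form of Brouwer's fixed point theorem). -/
theorem exists_zero_of_inner_pos {E : Type*} [NormedAddCommGroup E] [InnerProductSpace ℝ E]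
    [FiniteDimensional ℝ E] {F : E → E} (hF : Continuous F) {R : ℝ} (hR : 0 < R)
    (hout : ∀ x, R ≤ ‖x‖ → 0 < inner ℝ (F x) x) : ∃ x, F x = 0 := by
  by_contra! hne
  -- deform `F` into the identity between the spheres of radius `R` and `2 R`
  set χ : E → ℝ := fun x => max 0 (min 1 ((‖x‖ - R) / R))
  have hχc : Continuous χ := by fun_prop
  have hχ0 : ∀ x, 0 ≤ χ x := fun x => le_max_left _ _
  have hχ1 : ∀ x, χ x ≤ 1 := fun x => max_le zero_le_one (min_le_left _ _)
  have hχR : ∀ x, ‖x‖ ≤ R → χ x = 0 := fun x hx => by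
    refine max_eq_left ((min_le_right _ _).trans ?_)
    exact div_nonpos_of_nonpos_of_nonneg (by linarith) hR.le
  have hχ2 : ∀ x, 2 * R ≤ ‖x‖ → χ x = 1 := fun x hx => by
    have : 1 ≤ (‖x‖ - R) / R := by rw [le_div_iff₀ hR]; linarith
    simp [χ, min_eq_left this]
  set k : E → E := fun x => (1 - χ x) • (F x - x)
  have hk : Continuous k := by fun_prop
  have hG : ∀ x, x + k x ≠ 0 := by
    intro x hx
    rcases le_total ‖x‖ R with h | h
    · simp [k, hχR x h] at hx; exact hne x hx
    · have h1 : inner ℝ (x + k x) x = (1 - χ x) * inner ℝ (F x) x + χ x * ‖x‖ ^ 2 := by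
        simp only [k, inner_add_left, inner_smul_left, inner_sub_left, real_inner_self_eq_norm_sq]
        simp; ring
      rw [hx, inner_zero_left] at h1
      have h2 := hout x h
      have h3 : 0 < ‖x‖ ^ 2 := by have := hR.trans_le h; positivity
      rcases (hχ1 x).lt_or_eq with h4 | h4
      · have := mul_pos (sub_pos.2 h4) h2
        have := mul_nonneg (hχ0 x) h3.le
        linarith
      · rw [h4] at h1; linarith
  have hksupp : ∀ x, 2 * R ≤ ‖x‖ → k x = 0 := fun x hx => by simp [k, hχ2 x hx]
  obtain ⟨H, hHs, hHk, hHsupp⟩ := hk.exists_contDiff_approx 1 (ε := fun x => ‖x + k x‖)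
    (by fun_prop) (fun x => norm_pos_iff.2 (hG x))
  have hne' : ∀ x, x + H x ≠ 0 := by
    intro x hx
    have h1 := hHk x
    have h2 : H x = -x := (neg_eq_of_add_eq_zero_right hx).symm
    rw [h2, dist_eq_norm, show -x - k x = -(x + k x) by abel, norm_neg] at h1
    exact lt_irrefl _ h1
  refine not_exists_contDiff_retraction (R := 2 * R) (by positivity)
    (f := fun x => (2 * R / ‖x + H x‖) • (x + H x)) ?_ ?_ ?_
  · have h1 : ContDiff ℝ 1 (fun x => x + H x) := contDiff_id.add hHs
    exact (contDiff_const.div (h1.norm ℝ hne') fun x => norm_ne_zero_iff.2 (hne' x)).smul h1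
  · intro x hx
    have hx' : ‖x‖ = 2 * R := by simpa using hx
    have : H x = 0 := by
      by_contra h
      exact hHsupp h (hksupp x hx'.ge)
    simp only [this, add_zero, hx']
    rw [div_self (by positivity), one_smul]
  · intro x
    have := norm_pos_iff.2 (hne' x)
    rw [norm_smul, norm_div, norm_norm, div_mul_cancel₀ _ this.ne', Real.norm_of_nonneg]
    positivity

/-- A solvability criterion for systems in triangular form: the first equation is coercive in its
own unknown `u`, uniformly in `z`, and the second one is coercive in `z` for bounded `u`. -/
theorem exists_common_zero_of_triangular_coercive {E₁ E₂ : Type*}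
    [NormedAddCommGroup E₁] [InnerProductSpace ℝ E₁] [FiniteDimensional ℝ E₁]
    [NormedAddCommGroup E₂] [InnerProductSpace ℝ E₂] [FiniteDimensional ℝ E₂]
    {F₁ : E₁ × E₂ → E₁} {F₂ : E₁ × E₂ → E₂} (h₁ : Continuous F₁) (h₂ : Continuous F₂) {c : ℝ}
    (hc₁ : ∀ u z, ‖u‖ - c ≤ inner ℝ (F₁ (u, z)) u)
    (hc₂ : ∀ M, ∃ b, ∀ u z, ‖u‖ ≤ M → ‖z‖ - b ≤ inner ℝ (F₂ (u, z)) z) :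
    ∃ u z, F₁ (u, z) = 0 ∧ F₂ (u, z) = 0 := by
  set M := max c 1
  have hM : 0 < M := lt_max_of_lt_right one_pos
  obtain ⟨b, hb⟩ := hc₂ M
  -- in the second equation `u` is truncated to the ball that contains every zero of the first
  set τ : E₁ → E₁ := fun u => (M / max M ‖u‖) • u
  have hτc : Continuous τ := by
    refine Continuous.smul (continuous_const.div (by fun_prop) fun u => ?_) continuous_id
    exact (lt_max_of_lt_left hM).ne'
  have hτM : ∀ u, ‖τ u‖ ≤ M := by
    intro u
    have h1 : 0 < max M ‖u‖ := lt_max_of_lt_left hM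
    rw [norm_smul, Real.norm_of_nonneg (by positivity), div_mul_eq_mul_div, div_le_iff₀ h1]
    gcongr
    exact le_max_right _ _
  have hτid : ∀ u, ‖u‖ ≤ M → τ u = u := by
    intro u hu
    simp [τ, max_eq_left hu, div_self hM.ne']
  set F : WithLp 2 (E₁ × E₂) → WithLp 2 (E₁ × E₂) := fun x =>
    WithLp.toLp 2 (F₁ (x.fst, x.snd), F₂ (τ x.fst, x.snd)) with hFdef
  have hF : Continuous F := by
    have hfst : Continuous fun x : WithLp 2 (E₁ × E₂) => x.fst := by fun_prop
    have hsnd : Continuous fun x : WithLp 2 (E₁ × E₂) => x.snd := by fun_prop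
    have := (h₁.comp (hfst.prodMk hsnd)).prodMk (h₂.comp ((hτc.comp hfst).prodMk hsnd))
    exact (WithLp.prod_continuous_toLp 2 E₁ E₂).comp this
  obtain ⟨x, hx⟩ := exists_zero_of_inner_pos hF (R := |c| + |b| + 1) (by positivity) (by
    intro x hx
    have hin : inner ℝ (F x) x
        = inner ℝ (F₁ (x.fst, x.snd)) x.fst + inner ℝ (F₂ (τ x.fst, x.snd)) x.snd := by
      rw [WithLp.prod_inner_apply]
      rfl
    have h1 := hc₁ x.fst x.snd
    have h2 := hb (τ x.fst) x.snd (hτM _)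
    have hn : ‖x‖ ≤ ‖x.fst‖ + ‖x.snd‖ := by
      have h3 := WithLp.prod_norm_sq_eq_of_L2 x
      have h4 := norm_nonneg x.fst
      have h5 := norm_nonneg x.snd
      refine abs_le_of_sq_le_sq' ?_ (by positivity) |>.2
      nlinarith
    have := le_abs_self c
    have := le_abs_self b
    rw [hin]
    linarith)
  have hx1 : F₁ (x.fst, x.snd) = 0 := congrArg (fun y => y.fst) hx
  have hx2 : F₂ (τ x.fst, x.snd) = 0 := congrArg (fun y => y.snd) hx
  have hu : ‖x.fst‖ ≤ M := by
    have := hc₁ x.fst x.snd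
    rw [hx1, inner_zero_left] at this
    exact (by linarith : ‖x.fst‖ ≤ c).trans (le_max_left _ _)
  rw [hτid _ hu] at hx2
  exact ⟨x.fst, x.snd, hx1, hx2⟩

variable {d : ℕ} {Ω : Set (Vec d)}

/-! ### Piecewise Lipschitz functions -/

open Set in
/-- Lipschitz bounds on the pieces of a finite closed cover glue to a global one: near each point
`x` every other point shares a piece with `x`, so the bound can be continued along segments. -/
theorem lipschitzWith_of_finite_closed_cover {E F ι : Type*} [NormedAddCommGroup E]
    [NormedSpace ℝ E] [NormedAddCommGroup F] [Finite ι] {A : ι → Set E}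
    (hA : ∀ i, IsClosed (A i)) (hcov : ∀ x, ∃ i, x ∈ A i) {f : E → F} {L : NNReal}
    (hf : ∀ i, LipschitzOnWith L f (A i)) : LipschitzWith L f := by
  have hloc : ∀ x, ∀ᶠ z in nhds x, dist (f z) (f x) ≤ L * dist z x := by
    intro x
    have h1 : ∀ i, ∀ᶠ z in nhds x, z ∈ A i → x ∈ A i := by
      intro i
      by_cases hx : x ∈ A i
      · exact Filter.Eventually.of_forall fun _ _ => hx
      · filter_upwards [(hA i).isOpen_compl.mem_nhds hx] with z hz hz'
        exact absurd hz' hz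
    filter_upwards [Filter.eventually_all.2 h1] with z hz
    obtain ⟨i, hi⟩ := hcov z
    exact (hf i).dist_le_mul z hi x (hz i hi)
  have hc : Continuous f := by
    refine continuous_iff_continuousAt.2 fun x => ?_
    rw [ContinuousAt, tendsto_iff_dist_tendsto_zero]
    refine squeeze_zero' (Filter.Eventually.of_forall fun _ => dist_nonneg) (hloc x) ?_
    have : Continuous fun z => (L : ℝ) * dist z x := by fun_prop
    simpa using this.tendsto x
  refine LipschitzWith.of_dist_le_mul fun y x => ?_
  set c : ℝ → E := fun s => x + s • (y - x)
  have hcc : Continuous c := by fun_prop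
  have hcd : ∀ s t, dist (c s) (c t) = |s - t| * dist y x := by
    intro s t
    rw [dist_eq_norm, dist_eq_norm, show c s - c t = (s - t) • (y - x) by
      simp only [c, sub_smul]; abel, norm_smul, Real.norm_eq_abs]
  set T : Set ℝ := {s | dist (f (c s)) (f x) ≤ L * (s * dist y x)}
  have hT : Icc (0 : ℝ) 1 ⊆ T := by
    refine IsClosed.Icc_subset_of_forall_exists_gt ?_ (by simp [T, c]) ?_
    · exact (isClosed_le (by fun_prop) (by fun_prop)).inter isClosed_Icc
    · rintro s ⟨hs, -⟩ t ht
      have h1 : ∀ᶠ s' in nhdsWithin s (Ioi s), dist (f (c s')) (f (c s)) ≤ L * dist (c s') (c s) :=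
        (hcc.continuousAt.eventually (hloc (c s))).filter_mono nhdsWithin_le_nhds
      obtain ⟨s', h2, h3⟩ := (h1.and (Ioc_mem_nhdsGT ht)).exists
      refine ⟨s', ?_, h3⟩
      rw [hcd, abs_of_pos (sub_pos.2 h3.1)] at h2
      have h4 : dist (f (c s)) (f x) ≤ L * (s * dist y x) := hs
      change dist (f (c s')) (f x) ≤ L * (s' * dist y x)
      calc _ ≤ _ := dist_triangle _ (f (c s)) _
        _ ≤ L * ((s' - s) * dist y x) + L * (s * dist y x) := add_le_add h2 h4
        _ = _ := by ring
  have := hT (right_mem_Icc.2 zero_le_one)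
  simpa [T, c] using this

theorem isClosed_refSimplex : IsClosed (refSimplex d) := by
  have h1 : refSimplex d = (⋂ i, {x : Vec d | 0 ≤ x i}) ∩ {x : Vec d | ∑ i, x i ≤ 1} := by
    ext x
    simp [refSimplex]
  rw [h1]
  exact (isClosed_iInter fun i => isClosed_le (by fun_prop) (by fun_prop)).inter
    (isClosed_le (by fun_prop) (by fun_prop))

theorem Mesh.mem_elem_iff (G : Mesh Ω) (k : Fin G.card) (x : Vec d) :
    x ∈ G.elem k ↔ G.F k x ∈ refSimplex d := by
  constructor
  · rintro ⟨y, hy, rfl⟩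
    simpa using hy
  · intro hx
    exact ⟨G.F k x, hx, by simp⟩

theorem Mesh.exists_mem_elem (G : Mesh Ω) {x : Vec d} (hx : x ∈ Ω) : ∃ k, x ∈ G.elem k := by
  have : x ∈ ⋃ k, (G.F k).symm '' refSimplex d := G.cover ▸ subset_closure hx
  simpa [Mesh.elem] using this

theorem Mesh.isClosed_elem (G : Mesh Ω) (k : Fin G.card) : IsClosed (G.elem k) := by
  have : G.elem k = G.F k ⁻¹' refSimplex d := Set.ext (G.mem_elem_iff k)
  rw [this]
  exact isClosed_refSimplex.preimage
    (AffineMap.continuous_of_finiteDimensional (G.F k : Vec d →ᵃ[ℝ] Vec d))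

/-- Finite element functions are Lipschitz: they are Lipschitz on each element and vanish off `Ω`. -/
theorem Mesh.exists_lipschitzWith {Y : Type*} [NormedAddCommGroup Y] (hΩ : IsOpen Ω) (G : Mesh Ω)
    {v : Vec d → Y} (h0 : ∀ x, x ∉ Ω → v x = 0)
    (hlip : ∀ k, ∃ K : NNReal, LipschitzWith K (fun y : refSimplex d => v ((G.F k).symm y))) :
    ∃ L, LipschitzWith L v := by
  choose K hK using hlip
  set N : Fin G.card → NNReal := fun k =>
    ‖LinearMap.toContinuousLinearMap ((G.F k).linear : Vec d →ₗ[ℝ] Vec d)‖₊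
  have hF : ∀ k x y, dist (G.F k x) (G.F k y) ≤ N k * dist x y := by
    intro k x y
    have h1 : G.F k x - G.F k y = (G.F k).linear (x - y) :=
      ((G.F k : Vec d →ᵃ[ℝ] Vec d).linearMap_vsub x y).symm
    rw [dist_eq_norm, dist_eq_norm, h1]
    exact (LinearMap.toContinuousLinearMap ((G.F k).linear : Vec d →ₗ[ℝ] Vec d)).le_opNorm _
  set L := ∑ k, K k * N k
  refine ⟨L, lipschitzWith_of_finite_closed_cover (ι := Option (Fin G.card))
    (A := fun o => o.elim Ωᶜ G.elem) ?_ ?_ ?_⟩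
  · rintro (_ | k)
    · exact hΩ.isClosed_compl
    · exact G.isClosed_elem k
  · intro x
    by_cases hx : x ∈ Ω
    · obtain ⟨k, hk⟩ := G.exists_mem_elem hx
      exact ⟨some k, hk⟩
    · exact ⟨none, hx⟩
  · rintro (_ | k)
    · refine LipschitzOnWith.of_dist_le_mul fun x hx y hy => ?_
      rw [h0 x hx, h0 y hy, dist_self]
      positivity
    · refine LipschitzOnWith.of_dist_le_mul fun x hx y hy => ?_
      have h1 := (hK k).dist_le_mul ⟨G.F k x, (G.mem_elem_iff k x).1 hx⟩
        ⟨G.F k y, (G.mem_elem_iff k y).1 hy⟩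
      simp only [AffineEquiv.symm_apply_apply] at h1
      have h2 : K k * N k ≤ L := Finset.single_le_sum (f := fun k => K k * N k)
        (fun _ _ => zero_le) (Finset.mem_univ k)
      calc dist (v x) (v y) ≤ K k * dist (G.F k x) (G.F k y) := h1
        _ ≤ K k * (N k * dist x y) := by gcongr; exact hF k x y
        _ = ((K k * N k : NNReal) : ℝ) * dist x y := by push_cast; ring
        _ ≤ L * dist x y := by gcongr

/-! ### Weak gradients -/

/-- Lipschitz functions on `ℝ^d` that vanish off `Ω`. For bounded `Ω` they have zero trace and belong
to every `W₀^{1,p}(Ω)`. -/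
structure LipZero (Ω : Set (Vec d)) (u : Vec d → ℝ) : Prop where
  lip : ∃ L, LipschitzWith L u
  zero : ∀ x, x ∉ Ω → u x = 0

theorem integrableOn_mul_of_tsupport_subset {u φ : Vec d → ℝ}
    (hu : LocallyIntegrableOn u Ω) (hφ : Continuous φ) (hc : HasCompactSupport φ)
    (hs : tsupport φ ⊆ Ω) : IntegrableOn (fun x => u x * φ x) Ω := by
  have h1 : IntegrableOn (fun x => u x * φ x) (tsupport φ) :=
    (hu.integrableOn_compact_subset hs hc).mul_continuousOn hφ.continuousOn hc
  refine ((integrableOn_iff_integrable_of_support_subset fun x hx => ?_).1 h1).integrableOn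
  exact subset_tsupport φ fun h => hx (by simp [h])

theorem locallyIntegrableOn_coord {g : Vec d → Vec d} (hg : LocallyIntegrableOn g Ω) (i : Fin d) :
    LocallyIntegrableOn (fun x => g x i) Ω := fun x hx => by
  obtain ⟨t, ht, hti⟩ := hg x hx
  exact ⟨t, ht, (EuclideanSpace.proj i : Vec d →L[ℝ] ℝ).integrable_comp hti⟩

theorem continuous_partial {φ : Vec d → ℝ} (hφ : ContDiff ℝ ∞ φ) (v : Vec d) :
    Continuous fun x => fderiv ℝ φ x v :=
  (hφ.continuous_fderiv (by simp)).clm_apply continuous_const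

theorem HasWeakGrad.ae_eq (hΩ : IsOpen Ω) {u : Vec d → ℝ} {g h : Vec d → Vec d}
    (hg : HasWeakGrad Ω u g) (hh : HasWeakGrad Ω u h) : g =ᵐ[volume.restrict Ω] h := by
  have key : ∀ i : Fin d, ∀ᵐ x ∂(volume : Measure (Vec d)), x ∈ Ω → g x i - h x i = 0 := by
    intro i
    refine hΩ.ae_eq_zero_of_integral_contDiff_smul_eq_zero
      ((locallyIntegrableOn_coord hg.2.1 i).sub (locallyIntegrableOn_coord hh.2.1 i)) ?_
    intro φ hφ hc hs
    have h1 : ∫ x, φ x • (g x i - h x i) = ∫ x in Ω, φ x • (g x i - h x i) := by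
      refine (setIntegral_eq_integral_of_forall_compl_eq_zero fun x hx => ?_).symm
      rw [image_eq_zero_of_notMem_tsupport fun h => hx (hs h), zero_smul]
    have e1 := hg.2.2 φ hφ hc hs i
    have e2 := hh.2.2 φ hφ hc hs i
    have h2 : ∫ x in Ω, φ x • (g x i - h x i)
        = (∫ x in Ω, g x i * φ x) - ∫ x in Ω, h x i * φ x := by
      rw [← integral_sub
        (integrableOn_mul_of_tsupport_subset (locallyIntegrableOn_coord hg.2.1 i) hφ.continuous hc hs)
        (integrableOn_mul_of_tsupport_subset (locallyIntegrableOn_coord hh.2.1 i) hφ.continuous hc hs)]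
      refine integral_congr_ae (Filter.Eventually.of_forall fun x => ?_)
      simp only [smul_eq_mul]; ring
    change ∫ x, φ x • (g x i - h x i) = 0
    rw [h1, h2]
    linarith
  filter_upwards [ae_restrict_of_ae (Filter.eventually_all.2 key),
    ae_restrict_mem hΩ.measurableSet] with x hx hxΩ
  ext i
  exact sub_eq_zero.1 (hx i hxΩ)

theorem hasWeakGrad_weakGrad {u : Vec d → ℝ} (h : ∃ g, HasWeakGrad Ω u g) :
    HasWeakGrad Ω u (weakGrad Ω u) := by
  rw [weakGrad, dif_pos h]
  exact h.choose_spec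

theorem HasWeakGrad.weakGrad_ae_eq (hΩ : IsOpen Ω) {u : Vec d → ℝ} {g : Vec d → Vec d}
    (hg : HasWeakGrad Ω u g) : weakGrad Ω u =ᵐ[volume.restrict Ω] g :=
  (hasWeakGrad_weakGrad ⟨g, hg⟩).ae_eq hΩ hg

theorem tsupport_partial_subset (φ : Vec d → ℝ) (v : Vec d) :
    tsupport (fun x => fderiv ℝ φ x v) ⊆ tsupport φ :=
  (closure_mono fun x hx => by
    have : fderiv ℝ φ x ≠ 0 := fun h => hx (by simp [h])
    exact this).trans (tsupport_fderiv_subset ℝ)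

theorem HasWeakGrad.add {u v : Vec d → ℝ} {g h : Vec d → Vec d}
    (hg : HasWeakGrad Ω u g) (hh : HasWeakGrad Ω v h) : HasWeakGrad Ω (u + v) (g + h) := by
  refine ⟨hg.1.add hh.1, hg.2.1.add hh.2.1, fun φ hφ hc hs i => ?_⟩
  have hc' : HasCompactSupport fun x => fderiv ℝ φ x (EuclideanSpace.single i 1) :=
    hc.fderiv_apply ℝ _
  have hs' := (tsupport_partial_subset φ (EuclideanSpace.single i 1)).trans hs
  have e1 := hg.2.2 φ hφ hc hs i
  have e2 := hh.2.2 φ hφ hc hs i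
  simp only [Pi.add_apply, PiLp.add_apply, add_mul]
  rw [integral_add (integrableOn_mul_of_tsupport_subset hg.1 (continuous_partial hφ _) hc' hs')
      (integrableOn_mul_of_tsupport_subset hh.1 (continuous_partial hφ _) hc' hs'),
    integral_add
      (integrableOn_mul_of_tsupport_subset (locallyIntegrableOn_coord hg.2.1 i) hφ.continuous hc hs)
      (integrableOn_mul_of_tsupport_subset (locallyIntegrableOn_coord hh.2.1 i) hφ.continuous hc hs),
    e1, e2]
  ring

theorem HasWeakGrad.smul {u : Vec d → ℝ} {g : Vec d → Vec d} (a : ℝ)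
    (hg : HasWeakGrad Ω u g) : HasWeakGrad Ω (a • u) (a • g) := by
  refine ⟨hg.1.smul a, hg.2.1.smul a, fun φ hφ hc hs i => ?_⟩
  simp only [Pi.smul_apply, PiLp.smul_apply, smul_eq_mul, mul_assoc, integral_const_mul]
  rw [hg.2.2 φ hφ hc hs i]
  ring

/-- The gradient of a Lipschitz function, by partial derivatives. -/
noncomputable def partialGrad (u : Vec d → ℝ) (x : Vec d) : Vec d :=
  WithLp.toLp 2 fun i => lineDeriv ℝ u x (EuclideanSpace.single i 1)

theorem norm_partialGrad_apply_le {u : Vec d → ℝ} {L : NNReal} (hL : LipschitzWith L u)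
    (x : Vec d) (i : Fin d) : |partialGrad u x i| ≤ L := by
  have := norm_lineDeriv_le_of_lipschitz ℝ hL (x₀ := x) (v := EuclideanSpace.single i 1)
  simpa [partialGrad] using this

theorem measurable_partialGrad {u : Vec d → ℝ} (hu : Continuous u) :
    Measurable (partialGrad u) := by
  refine (WithLp.measurable_toLp 2 _).comp (measurable_pi_lambda _ fun i => ?_)
  exact measurable_lineDeriv hu

/-- The derivative of a Lipschitz function vanishes at almost every zero of the function. -/
theorem LipZero.ae_lineDeriv_eq_zero (hΩ : IsOpen Ω) {u : Vec d → ℝ} (hu : LipZero Ω u)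
    (v : Vec d) : ∀ᵐ x, x ∉ Ω → lineDeriv ℝ u x v = 0 := by
  obtain ⟨L, hL⟩ := hu.lip
  rcases eq_or_ne v 0 with rfl | hv
  · exact Filter.Eventually.of_forall fun x _ => lineDeriv_zero
  set s : Set (Vec d) := Ωᶜ ∩ {x | DifferentiableAt ℝ u x}
  have hs : MeasurableSet s :=
    hΩ.measurableSet.compl.inter (measurableSet_of_differentiableAt ℝ u)
  have happ : ApproximatesLinearOn (fun x => u x • v) (0 : Vec d →L[ℝ] Vec d) s 0 := by
    intro x hx y hy
    simp [hu.zero x hx.1, hu.zero y hy.1]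
  have := happ.norm_fderiv_sub_le volume hs (fun x => (fderiv ℝ u x).smulRight v)
    (fun x hx => (hx.2.hasFDerivAt.smul_const v).hasFDerivWithinAt)
  rw [ae_restrict_iff' hs] at this
  filter_upwards [this, hL.ae_differentiableAt] with x hx hxd hxΩ
  have h1 := hx ⟨hxΩ, hxd⟩
  have h2 : (fderiv ℝ u x).smulRight v = 0 := 
    nnnorm_eq_zero.1 (le_zero_iff.1 (by simpa only [sub_zero] using h1))
  have h3 : fderiv ℝ u x v • v = 0 := congrArg (fun T : Vec d →L[ℝ] Vec d => T v) h2
  rw [hxd.lineDeriv_eq_fderiv]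
  exact (smul_eq_zero.1 h3).resolve_right hv

theorem LipZero.hasCompactSupport (hb : Bornology.IsBounded Ω) {u : Vec d → ℝ} (hu : LipZero Ω u) :
    HasCompactSupport u :=
  HasCompactSupport.of_support_subset_isCompact hb.isCompact_closure fun x hx =>
    subset_closure (by_contra fun h => hx (hu.zero x h))

/-- Green's formula for Lipschitz functions that vanish off `Ω`, with smooth test functions that need
not vanish on the boundary. -/
theorem LipZero.integral_mul_partial (hΩ : IsOpen Ω) {u : Vec d → ℝ} (hu : LipZero Ω u)
    {φ : Vec d → ℝ} (hφ : ContDiff ℝ ∞ φ) (hc : HasCompactSupport φ) (i : Fin d) :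
    ∫ x in Ω, u x * fderiv ℝ φ x (EuclideanSpace.single i 1)
      = - ∫ x in Ω, partialGrad u x i * φ x := by
  obtain ⟨L, hL⟩ := hu.lip
  obtain ⟨D, hD⟩ : ∃ D, LipschitzWith D φ := ContDiff.lipschitzWith_of_hasCompactSupport hc hφ (by simp)
  have h1 := LipschitzWith.integral_lineDeriv_mul_eq (μ := volume) hL hD hc
    (EuclideanSpace.single i (1 : ℝ))
  have h2 : ∫ x in Ω, u x * fderiv ℝ φ x (EuclideanSpace.single i 1)
      = ∫ x, u x * fderiv ℝ φ x (EuclideanSpace.single i 1) :=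
    setIntegral_eq_integral_of_forall_compl_eq_zero fun x hx => by rw [hu.zero x hx, zero_mul]
  have h3 : ∫ x in Ω, partialGrad u x i * φ x
      = ∫ x, lineDeriv ℝ u x (EuclideanSpace.single i 1) * φ x := by
    refine setIntegral_eq_integral_of_ae_compl_eq_zero ?_
    filter_upwards [hu.ae_lineDeriv_eq_zero hΩ (EuclideanSpace.single i 1)] with x hx hxΩ
    rw [show partialGrad u x i = lineDeriv ℝ u x (EuclideanSpace.single i 1) from rfl, hx hxΩ,
      zero_mul]
  rw [h2, h3, h1, ← integral_neg]
  refine integral_congr_ae (Filter.Eventually.of_forall fun x => ?_)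
  simp only
  rw [lineDeriv_neg, ((hφ.differentiable (by simp)) x).lineDeriv_eq_fderiv]
  ring

theorem LipZero.hasWeakGrad (hΩ : IsOpen Ω) {u : Vec d → ℝ} (hu : LipZero Ω u) :
    HasWeakGrad Ω u (partialGrad u) := by
  obtain ⟨L, hL⟩ := hu.lip
  refine ⟨hL.continuous.locallyIntegrable.locallyIntegrableOn Ω, ?_,
    fun φ hφ hc _ i => hu.integral_mul_partial hΩ hφ hc i⟩
  have hb : ∀ x, ‖partialGrad u x‖ ≤ Real.sqrt (∑ _i : Fin d, (L : ℝ) ^ 2) := by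
    intro x
    rw [EuclideanSpace.norm_eq]
    refine Real.sqrt_le_sqrt (Finset.sum_le_sum fun i _ => ?_)
    rw [Real.norm_eq_abs]
    exact pow_le_pow_left₀ (abs_nonneg _) (norm_partialGrad_apply_le hL x i) 2
  refine LocallyIntegrable.locallyIntegrableOn ?_ Ω
  exact (continuous_const (y := Real.sqrt (∑ _i : Fin d, (L : ℝ) ^ 2))).locallyIntegrable.mono
    (measurable_partialGrad hL.continuous).aestronglyMeasurable
    (Filter.Eventually.of_forall fun x => (hb x).trans (le_abs_self _))

theorem LipZero.weakGrad_ae_eq (hΩ : IsOpen Ω) {u : Vec d → ℝ} (hu : LipZero Ω u) :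
    weakGrad Ω u =ᵐ[volume.restrict Ω] partialGrad u :=
  (hu.hasWeakGrad hΩ).weakGrad_ae_eq hΩ

theorem LipZero.exists_bound_weakGrad (hΩ : IsOpen Ω) {u : Vec d → ℝ} (hu : LipZero Ω u) :
    ∃ L : ℝ, 0 ≤ L ∧ ∀ᵐ x ∂volume.restrict Ω, ∀ i, |weakGrad Ω u x i| ≤ L := by
  obtain ⟨L, hL⟩ := hu.lip
  refine ⟨L, L.2, ?_⟩
  filter_upwards [hu.weakGrad_ae_eq hΩ] with x hx i
  rw [hx]
  exact norm_partialGrad_apply_le hL x i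

theorem LipZero.exists_bound (hb : Bornology.IsBounded Ω) {u : Vec d → ℝ} (hu : LipZero Ω u) :
    ∃ L : ℝ, 0 ≤ L ∧ ∀ x, |u x| ≤ L := by
  obtain ⟨L, hL⟩ := hu.lip
  obtain ⟨C, hC⟩ := (hu.hasCompactSupport hb).exists_bound_of_continuous hL.continuous
  exact ⟨max C 0, le_max_right _ _, fun x => (hC x).trans (le_max_left _ _)⟩

theorem LipZero.continuous {u : Vec d → ℝ} (hu : LipZero Ω u) : Continuous u := by
  obtain ⟨L, hL⟩ := hu.lip
  exact hL.continuous

theorem aestronglyMeasurable_weakGrad {u : Vec d → ℝ} (h : ∃ g, HasWeakGrad Ω u g) :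
    AEStronglyMeasurable (weakGrad Ω u) (volume.restrict Ω) :=
  (hasWeakGrad_weakGrad h).2.1.aestronglyMeasurable

theorem LipZero.memW10 (hΩ : IsOpen Ω) (hb : Bornology.IsBounded Ω) {u : Vec d → ℝ}
    (hu : LipZero Ω u) (p : ℝ≥0∞) : MemW10 p Ω u := by
  have : IsFiniteMeasure (volume.restrict Ω) := ⟨by simpa using hb.measure_lt_top⟩
  obtain ⟨C, hC0, hC⟩ := hu.exists_bound hb
  obtain ⟨L, hL0, hL⟩ := hu.exists_bound_weakGrad hΩ
  have hex : ∃ g, HasWeakGrad Ω u g := ⟨_, hu.hasWeakGrad hΩ⟩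
  refine ⟨⟨?_, hex, ?_⟩, fun φ hφ hc i => ?_⟩
  · exact MemLp.of_bound hu.continuous.aestronglyMeasurable C (Filter.Eventually.of_forall hC)
  · refine MemLp.of_bound (aestronglyMeasurable_weakGrad hex)
      (Real.sqrt (∑ _i : Fin d, L ^ 2)) ?_
    filter_upwards [hL] with x hx
    rw [EuclideanSpace.norm_eq]
    refine Real.sqrt_le_sqrt (Finset.sum_le_sum fun i _ => ?_)
    rw [Real.norm_eq_abs]
    exact pow_le_pow_left₀ (abs_nonneg _) (hx i) 2
  · rw [hu.integral_mul_partial hΩ hφ hc i]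
    congr 1
    refine integral_congr_ae ?_
    filter_upwards [hu.weakGrad_ae_eq hΩ] with x hx
    rw [hx]

/-- A Poincaré-type uniqueness statement: a single vanishing partial derivative forces a Lipschitz
function that vanishes off a bounded set to be zero. It follows from the integration by parts
`∫ |u| = ∫ |u| ∂ᵢ xᵢ = - ∫ xᵢ ∂ᵢ|u|`. -/
theorem LipZero.eq_zero_of_partial_eq_zero (hΩ : IsOpen Ω) (hb : Bornology.IsBounded Ω)
    {u : Vec d → ℝ} (hu : LipZero Ω u) (i : Fin d)
    (h : ∀ᵐ x ∂volume.restrict Ω, weakGrad Ω u x i = 0) : u = 0 := by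
  obtain ⟨L, hL⟩ := hu.lip
  set e : Vec d := EuclideanSpace.single i (1 : ℝ)
  have h1 : ∀ᵐ x, lineDeriv ℝ u x e = 0 := by
    have h2 : ∀ᵐ x ∂volume.restrict Ω, lineDeriv ℝ u x e = 0 := by
      filter_upwards [h, hu.weakGrad_ae_eq hΩ] with x hx hx2
      rw [hx2] at hx
      exact hx
    rw [ae_restrict_iff' hΩ.measurableSet] at h2
    filter_upwards [h2, hu.ae_lineDeriv_eq_zero hΩ e] with x hx hx'
    by_cases hxΩ : x ∈ Ω
    · exact hx hxΩ
    · exact hx' hxΩ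
  have h2 : ∀ᵐ x, lineDeriv ℝ (fun y => |u y|) x (-e) = 0 := by
    filter_upwards [h1, hL.ae_lineDifferentiableAt (μ := volume) e] with x hx hxd
    have h3 : HasDerivAt (fun t : ℝ => u (x + t • e)) 0 0 := by
      have := hxd.hasLineDerivAt
      rw [hx] at this
      exact this
    have h4 : HasLineDerivAt ℝ (fun y => |u y|) 0 x e := by
      unfold HasLineDerivAt
      rw [hasDerivAt_iff_isLittleO] at h3 ⊢
      refine Asymptotics.IsBigO.trans_isLittleO ?_ h3
      refine Asymptotics.IsBigO.of_bound 1 (Filter.Eventually.of_forall fun t => ?_)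
      simpa using abs_abs_sub_abs_le (u (x + t • e)) (u x)
    rw [lineDeriv_neg, h4.lineDeriv, neg_zero]
  have hcs := hu.hasCompactSupport hb
  have hcs' : HasCompactSupport fun y => |u y| := hcs.comp_left (g := abs) abs_zero
  have hLabs : LipschitzWith L fun y => |u y| := by
    refine LipschitzWith.of_dist_le_mul fun x y => ?_
    rw [Real.dist_eq]
    exact (abs_abs_sub_abs_le _ _).trans (hL.dist_le_mul x y)
  have h3 := LipschitzWith.integral_lineDeriv_mul_eq (μ := volume)
    (EuclideanSpace.proj i : Vec d →L[ℝ] ℝ).lipschitz hLabs hcs' e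
  have h4 : ∫ x, |u x| = 0 := by
    have h5 : ∀ x, lineDeriv ℝ (EuclideanSpace.proj i : Vec d →L[ℝ] ℝ) x e = 1 := by
      intro x
      rw [(EuclideanSpace.proj i : Vec d →L[ℝ] ℝ).differentiableAt.lineDeriv_eq_fderiv,
        ContinuousLinearMap.fderiv]
      simp [e]
    simp only [h5, one_mul] at h3
    rw [h3]
    refine integral_eq_zero_of_ae ?_
    filter_upwards [h2] with x hx
    simp [hx]
  have h5 := (integral_eq_zero_iff_of_nonneg (fun x => abs_nonneg (u x))
    (hLabs.continuous.integrable_of_hasCompactSupport hcs')).1 h4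
  have h6 := (hLabs.continuous.ae_eq_iff_eq volume continuous_const).1 h5
  funext x
  exact abs_eq_zero.1 (congrFun h6 x)

/-! ### Dominated families of functions -/

/-- A family `F e` of functions that depends on a parameter `e` so that, after modification of each
`F e` on a null set, it is continuous in `e` at every point, and that is dominated by an
`L^p`-function as long as `e` is bounded. This is what dominated convergence needs. -/
def DominatedFamily {X E : Type*} [MeasurableSpace X] [NormedAddCommGroup E] (p : ℝ≥0∞)
    (μ : Measure X) (F : E → X → ℝ) : Prop :=
  ∃ F' : E → X → ℝ, (∀ e, F e =ᵐ[μ] F' e) ∧ (∀ e, AEStronglyMeasurable (F' e) μ) ∧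
    (∀ x, Continuous fun e => F' e x) ∧
    ∀ r : ℝ, ∃ g, MemLp g p μ ∧ ∀ e, ‖e‖ ≤ r → ∀ᵐ x ∂μ, ‖F' e x‖ ≤ g x

namespace DominatedFamily

variable {X E : Type*} [MeasurableSpace X] [NormedAddCommGroup E] {μ : Measure X} {p : ℝ≥0∞}
  {F H : E → X → ℝ}

theorem congr (hF : DominatedFamily p μ F) (h : ∀ e, H e =ᵐ[μ] F e) : DominatedFamily p μ H := by
  obtain ⟨F', h1, h2⟩ := hF
  exact ⟨F', fun e => (h e).trans (h1 e), h2⟩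

theorem aestronglyMeasurable (hF : DominatedFamily p μ F) (e : E) :
    AEStronglyMeasurable (F e) μ := by
  obtain ⟨F', h1, h2, -⟩ := hF
  exact (h2 e).congr (h1 e).symm

theorem memLp (hF : DominatedFamily p μ F) (e : E) : MemLp (F e) p μ := by
  obtain ⟨F', h1, h2, h3, h4⟩ := hF
  obtain ⟨g, hg, hb⟩ := h4 ‖e‖
  refine (hg.mono (h2 e) ?_).ae_eq (h1 e).symm
  filter_upwards [hb e le_rfl] with x hx
  exact hx.trans (le_abs_self _)

theorem integrable (hF : DominatedFamily 1 μ F) (e : E) : Integrable (F e) μ :=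
  memLp_one_iff_integrable.1 (hF.memLp e)

theorem continuous_integral (hF : DominatedFamily 1 μ F) : Continuous fun e => ∫ x, F e x ∂μ := by
  obtain ⟨F', h1, h2, h3, h4⟩ := hF
  have h5 : (fun e => ∫ x, F e x ∂μ) = fun e => ∫ x, F' e x ∂μ :=
    funext fun e => integral_congr_ae (h1 e)
  rw [h5, continuous_iff_continuousAt]
  intro e₀
  obtain ⟨g, hg, hb⟩ := h4 (‖e₀‖ + 1)
  refine continuousAt_of_dominated (bound := g) (Filter.Eventually.of_forall h2) ?_
    (memLp_one_iff_integrable.1 hg) (Filter.Eventually.of_forall fun x => (h3 x).continuousAt)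
  have : ∀ᶠ e in nhds e₀, ‖e‖ < ‖e₀‖ + 1 :=
    continuous_norm.continuousAt.eventually (gt_mem_nhds (by linarith))
  filter_upwards [this] with e he
  exact hb e he.le

theorem of_memLp {f : X → ℝ} (hf : MemLp f p μ) : DominatedFamily p μ fun _ : E => f :=
  ⟨fun _ => f, fun _ => Filter.EventuallyEq.rfl, fun _ => hf.1, fun _ => continuous_const,
    fun _ => ⟨fun x => ‖f x‖, hf.norm, fun _ _ => Filter.Eventually.of_forall fun _ => le_rfl⟩⟩

theorem of_continuous [ProperSpace E] {a : E → ℝ} (ha : Continuous a) :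
    DominatedFamily ∞ μ fun e (_ : X) => a e := by
  refine ⟨fun e _ => a e, fun _ => Filter.EventuallyEq.rfl, fun _ => aestronglyMeasurable_const,
    fun _ => ha, fun r => ?_⟩
  obtain ⟨C, hC⟩ := (isCompact_closedBall (0 : E) r).exists_bound_of_continuousOn ha.continuousOn
  exact ⟨fun _ => C, memLp_top_const C, fun e he => Filter.Eventually.of_forall fun _ =>
    hC e (by simpa using he)⟩

theorem add (hF : DominatedFamily p μ F) (hH : DominatedFamily p μ H) :
    DominatedFamily p μ fun e x => F e x + H e x := by
  obtain ⟨F', h1, h2, h3, h4⟩ := hF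
  obtain ⟨H', k1, k2, k3, k4⟩ := hH
  refine ⟨fun e x => F' e x + H' e x, fun e => (h1 e).add (k1 e), fun e => (h2 e).add (k2 e),
    fun x => (h3 x).add (k3 x), fun r => ?_⟩
  obtain ⟨g, hg, hb⟩ := h4 r
  obtain ⟨g', hg', hb'⟩ := k4 r
  refine ⟨fun x => g x + g' x, hg.add hg', fun e he => ?_⟩
  filter_upwards [hb e he, hb' e he] with x hx hx'
  exact (norm_add_le _ _).trans (add_le_add hx hx')

theorem mul {q s : ℝ≥0∞} [ENNReal.HolderTriple p q s] (hF : DominatedFamily p μ F)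
    (hH : DominatedFamily q μ H) : DominatedFamily s μ fun e x => F e x * H e x := by
  obtain ⟨F', h1, h2, h3, h4⟩ := hF
  obtain ⟨H', k1, k2, k3, k4⟩ := hH
  refine ⟨fun e x => F' e x * H' e x, fun e => (h1 e).mul (k1 e), fun e => (h2 e).mul (k2 e),
    fun x => (h3 x).mul (k3 x), fun r => ?_⟩
  obtain ⟨g, hg, hb⟩ := h4 r
  obtain ⟨g', hg', hb'⟩ := k4 r
  refine ⟨fun x => g x * g' x, hg'.mul hg, fun e he => ?_⟩
  filter_upwards [hb e he, hb' e he] with x hx hx'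
  rw [norm_mul]
  exact mul_le_mul hx hx' (norm_nonneg _) ((norm_nonneg _).trans hx)

theorem abs (hF : DominatedFamily p μ F) : DominatedFamily p μ fun e x => |F e x| := by
  obtain ⟨F', h1, h2, h3, h4⟩ := hF
  refine ⟨fun e x => |F' e x|, fun e => (h1 e).fun_comp fun y : ℝ => |y|, fun e => (h2 e).norm,
    fun x => (h3 x).abs, fun r => ?_⟩
  obtain ⟨g, hg, hb⟩ := h4 r
  exact ⟨g, hg, fun e he => (hb e he).mono fun x hx => by simpa using hx⟩

theorem sum {ι : Type*} (s : Finset ι) {F : ι → E → X → ℝ}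
    (hF : ∀ i ∈ s, DominatedFamily p μ (F i)) :
    DominatedFamily p μ fun e x => ∑ i ∈ s, F i e x := by
  classical
  induction s using Finset.induction_on with
  | empty =>
    simp only [Finset.sum_empty]
    exact of_memLp (f := fun _ => 0) MemLp.zero
  | insert i s hi ih =>
    simp only [Finset.sum_insert hi]
    exact (hF i (Finset.mem_insert_self _ _)).add
      (ih fun j hj => hF j (Finset.mem_insert_of_mem hj))

theorem const_mul (hF : DominatedFamily p μ F) (c : ℝ) :
    DominatedFamily p μ fun e x => c * F e x :=
  (of_memLp (memLp_top_const c)).mul hF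

theorem sub (hF : DominatedFamily p μ F) (hH : DominatedFamily p μ H) :
    DominatedFamily p μ fun e x => F e x - H e x :=
  (hF.add (hH.const_mul (-1))).congr fun e => Filter.Eventually.of_forall fun x => by
    simp only; ring

theorem mono_exponent [IsFiniteMeasure μ] {q : ℝ≥0∞} (hF : DominatedFamily p μ F) (hq : q ≤ p) :
    DominatedFamily q μ F := by
  obtain ⟨F', h1, h2, h3, h4⟩ := hF
  refine ⟨F', h1, h2, h3, fun r => ?_⟩
  obtain ⟨g, hg, hb⟩ := h4 r
  exact ⟨g, hg.mono_exponent hq, hb⟩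

end DominatedFamily

theorem exists_ae_le_of_memLp_top {X : Type*} [MeasurableSpace X] {μ : Measure X} {g : X → ℝ}
    (hg : MemLp g ∞ μ) : ∃ C : ℝ, 0 ≤ C ∧ ∀ᵐ x ∂μ, g x ≤ C := by
  refine ⟨(eLpNormEssSup g μ).toReal, ENNReal.toReal_nonneg, ?_⟩
  have h := hg.2
  rw [eLpNorm_exponent_top] at h
  filter_upwards [ae_le_eLpNormEssSup (f := g) (μ := μ)] with x hx
  have : ‖g x‖ ≤ (eLpNormEssSup g μ).toReal := by
    rw [← toReal_enorm]
    exact ENNReal.toReal_mono h.ne hx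
  exact (le_abs_self _).trans this

theorem aestronglyMeasurable_pi_of_apply {X ι Y : Type*} [MeasurableSpace X] {μ : Measure X}
    [Finite ι] [NormedAddCommGroup Y] [SecondCountableTopology Y] {f : X → ι → Y}
    (hf : ∀ i, AEStronglyMeasurable (fun x => f x i) μ) : AEStronglyMeasurable f μ := by
  borelize Y
  exact (aemeasurable_pi_iff.2 fun i => (hf i).aemeasurable).aestronglyMeasurable

/-! ### Tensors and constitutive laws -/

theorem tnorm_nonneg (A : Ten d) : 0 ≤ tnorm A := Real.sqrt_nonneg _

theorem abs_apply_le_tnorm (A : Ten d) (i j : Fin d) : |A i j| ≤ tnorm A := by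
  rw [tnorm, ← Real.sqrt_sq_eq_abs]
  refine Real.sqrt_le_sqrt ?_
  rw [pow_two]
  refine le_trans ?_ (Finset.single_le_sum (f := fun i => ∑ j, A i j * A i j)
    (fun _ _ => Finset.sum_nonneg fun _ _ => mul_self_nonneg _) (Finset.mem_univ i))
  exact Finset.single_le_sum (f := fun j => A i j * A i j) (fun _ _ => mul_self_nonneg _)
    (Finset.mem_univ j)

theorem tnorm_le_sum_abs (A : Ten d) : tnorm A ≤ ∑ i, ∑ j, |A i j| := by
  refine Real.sqrt_le_iff.2 ⟨Finset.sum_nonneg fun _ _ => Finset.sum_nonneg fun _ _ =>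
    abs_nonneg _, ?_⟩
  have h1 : ∀ i j, |A i j| ≤ ∑ i, ∑ j, |A i j| := fun i j =>
    (Finset.single_le_sum (f := fun j => |A i j|) (fun _ _ => abs_nonneg _)
      (Finset.mem_univ j)).trans
    (Finset.single_le_sum (f := fun i => ∑ j, |A i j|)
      (fun _ _ => Finset.sum_nonneg fun _ _ => abs_nonneg _) (Finset.mem_univ i))
  rw [pow_two, tdot, Finset.sum_mul]
  refine Finset.sum_le_sum fun i _ => ?_
  rw [Finset.sum_mul]
  refine Finset.sum_le_sum fun j _ => ?_
  rw [← abs_mul_abs_self]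
  exact mul_le_mul_of_nonneg_left (h1 i j) (abs_nonneg _)

/-- The symmetric part of a tensor. -/
noncomputable def symPart (A : Ten d) : Ten d := (1 / 2 : ℝ) • (A + A.transpose)

theorem isSymm_symPart (A : Ten d) : (symPart A).IsSymm := by
  ext i j
  simp only [symPart, Matrix.smul_apply, Matrix.add_apply, Matrix.transpose_apply, smul_eq_mul]
  ring

theorem symPart_of_isSymm {A : Ten d} (hA : A.IsSymm) : symPart A = A := by
  ext i j
  have := hA.apply i j
  simp only [symPart, Matrix.smul_apply, Matrix.add_apply, Matrix.transpose_apply, smul_eq_mul, this]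
  ring

theorem continuous_symPart : Continuous (symPart : Ten d → Ten d) := by
  unfold symPart
  fun_prop

namespace ConstitutiveLaws

variable {S : ℝ → Ten d → Ten d} {q : ℝ → Vec d → Ten d → Vec d} {r : ℝ → ℝ} {rm rp : ℝ}

/-- The constant extension to negative concentrations of admissible laws on `[0, ∞)` is admissible
on the whole line. -/
theorem comp_max (h : ConstitutiveLaws (Set.Ici 0) S q r rm rp) :
    ConstitutiveLaws Set.univ (fun ξ => S (max ξ 0)) (fun ξ => q (max ξ 0)) (fun ξ => r (max ξ 0))
      rm rp := by
  have hm : ∀ ξ : ℝ, max ξ 0 ∈ Set.Ici (0 : ℝ) := fun ξ => Set.mem_Ici.2 (le_max_right _ _)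
  refine ⟨h.one_lt, fun ξ _ => h.bounds _ (hm ξ), ?_, fun ξ _ => h.stress_symm _ (hm ξ), ?_, ?_,
    fun ξ _ => h.stress_mono _ (hm ξ), ?_, ?_, fun ξ _ => h.flux_linear _ (hm ξ), ?_, ?_⟩
  · obtain ⟨C, α, h1, h2, h3⟩ := h.holder
    refine ⟨C, α, h1, h2, fun x _ y _ => (h3 _ (hm x) _ (hm y)).trans ?_⟩
    gcongr
    have : LipschitzWith 1 fun ξ : ℝ => max ξ 0 := LipschitzWith.id.max_const 0
    simpa using this x y
  · exact h.stress_cont.comp (f := fun z : ℝ × Ten d => (max z.1 0, z.2)) (by fun_prop)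
      fun z hz => ⟨hm _, hz.2⟩
  · obtain ⟨C, h1, h2⟩ := h.stress_growth
    exact ⟨C, h1, fun ξ _ => h2 _ (hm ξ)⟩
  · obtain ⟨C, C', h1, h2, h3⟩ := h.stress_coercive
    exact ⟨C, C', h1, h2, fun ξ _ => h3 _ (hm ξ)⟩
  · exact h.flux_cont.comp (f := fun z : ℝ × Vec d × Ten d => (max z.1 0, z.2)) (by fun_prop)
      fun z hz => ⟨hm _, hz.2⟩
  · obtain ⟨C, h1, h2⟩ := h.flux_growth
    exact ⟨C, h1, fun ξ _ => h2 _ (hm ξ)⟩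
  · obtain ⟨C, h1, h2⟩ := h.flux_coercive
    exact ⟨C, h1, fun ξ _ => h2 _ (hm ξ)⟩

variable (h : ConstitutiveLaws Set.univ S q r rm rp)
include h

theorem continuous_stress_symPart :
    Continuous fun z : ℝ × Ten d => S z.1 (symPart z.2) :=
  h.stress_cont.comp_continuous (f := fun z : ℝ × Ten d => (z.1, symPart z.2))
    (continuous_fst.prodMk (continuous_symPart.comp continuous_snd))
    fun z => ⟨Set.mem_univ _, isSymm_symPart z.2⟩

theorem continuous_flux_symPart :
    Continuous fun z : ℝ × Vec d × Ten d => q z.1 z.2.1 (symPart z.2.2) :=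
  h.flux_cont.comp_continuous (f := fun z : ℝ × Vec d × Ten d => (z.1, z.2.1, symPart z.2.2))
    (continuous_fst.prodMk ((continuous_fst.comp continuous_snd).prodMk
      (continuous_symPart.comp (continuous_snd.comp continuous_snd))))
    fun z => ⟨Set.mem_univ _, Set.mem_univ _, isSymm_symPart z.2.2⟩

/-- The stress is bounded for bounded strain rates, uniformly in the concentration. -/
theorem exists_stress_bound (T : ℝ) : ∃ K : ℝ, ∀ ξ, ∀ B : Ten d, B.IsSymm → tnorm B ≤ T →
    ∀ i j, |S ξ B i j| ≤ K := by
  obtain ⟨C, hC, hg⟩ := h.stress_growth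
  refine ⟨C * (max T 1 ^ (rp - 1) + 1), fun ξ B hB hT i j => ?_⟩
  refine (abs_apply_le_tnorm _ i j).trans ((hg ξ (Set.mem_univ _) B hB).trans ?_)
  have h1 := h.bounds ξ (Set.mem_univ _)
  have h2 := h.one_lt
  gcongr
  calc tnorm B ^ (r ξ - 1) ≤ max T 1 ^ (r ξ - 1) :=
        Real.rpow_le_rpow (tnorm_nonneg B) (hT.trans (le_max_left _ _)) (by linarith)
    _ ≤ max T 1 ^ (rp - 1) :=
        Real.rpow_le_rpow_of_exponent_le (le_max_right _ _) (by linarith)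

/-- The power of work `S : B` grows superlinearly in `B`, uniformly in the concentration. -/
theorem exists_stress_linear_lower_bound (a : ℝ) : ∃ c : ℝ, ∀ ξ, ∀ B : Ten d, B.IsSymm →
    a * tnorm B - c ≤ tdot (S ξ B) B := by
  obtain ⟨C₂, C₃, h2, h3, hco⟩ := h.stress_coercive
  have hrm := h.one_lt
  set A := max (a / C₂) 1
  have hA : 1 ≤ A := le_max_right _ _
  -- beyond the threshold `T` one has `s ^ rm ≥ A s`
  set T := A ^ (1 / (rm - 1))
  have hT1 : 1 ≤ T := Real.one_le_rpow hA (by have := sub_pos.2 hrm; positivity)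
  have hT : T ^ (rm - 1) = A := by
    rw [← Real.rpow_mul (by linarith), one_div, inv_mul_cancel₀ (sub_pos.2 hrm).ne', Real.rpow_one]
  refine ⟨C₂ * (A * T) + C₃, fun ξ B hB => ?_⟩
  have h4 := hco ξ (Set.mem_univ _) B hB
  have hr := (h.bounds ξ (Set.mem_univ _)).1
  set s := tnorm B
  have hs : 0 ≤ s := tnorm_nonneg B
  have h5 : A * s - A * T ≤ s ^ r ξ := by
    rcases le_total T s with hTs | hTs
    · have hs1 : 1 ≤ s := hT1.trans hTs
      have h6 : s ^ rm = s ^ (rm - 1) * s := by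
        rw [← Real.rpow_add_one (by linarith), sub_add_cancel]
      have h7 : A ≤ s ^ (rm - 1) := by
        rw [← hT]; exact Real.rpow_le_rpow (by linarith) hTs (by linarith)
      have h8 : s ^ rm ≤ s ^ r ξ := Real.rpow_le_rpow_of_exponent_le hs1 hr
      nlinarith
    · have := Real.rpow_nonneg hs (r ξ)
      nlinarith
  have h6 : 0 ≤ tnorm (S ξ B) ^ (r ξ / (r ξ - 1)) := Real.rpow_nonneg (tnorm_nonneg _) _
  have h7 : a ≤ C₂ * A := by
    rw [mul_comm]; exact (div_le_iff₀ h2).1 (le_max_left _ _)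
  have h8 : a * s ≤ C₂ * A * s := mul_le_mul_of_nonneg_right h7 hs
  nlinarith

section Families

variable {X E : Type*} [MeasurableSpace X] [NormedAddCommGroup E] {μ : Measure X}
  {C : E → X → ℝ} {g : E → X → Vec d} {D : E → X → Ten d}

theorem dominatedFamily_stress (hC : DominatedFamily 1 μ C)
    (hD : ∀ i j, DominatedFamily ∞ μ fun e x => D e x i j) (hsymm : ∀ e x, (D e x).IsSymm)
    (i j : Fin d) : DominatedFamily ∞ μ fun e x => S (C e x) (D e x) i j := by
  obtain ⟨C', c1, c2, c3, -⟩ := hC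
  choose D' d1 d2 d3 d4 using hD
  set B : E → X → Ten d := fun e x => Matrix.of fun k l => D' k l e x
  have hB : ∀ e, D e =ᵐ[μ] fun x => B e x := fun e => by
    filter_upwards [Filter.eventually_all.2 fun k => Filter.eventually_all.2 fun l => d1 k l e]
      with x hx
    ext k l
    exact hx k l
  have hcont := h.continuous_stress_symPart
  refine ⟨fun e x => S (C' e x) (symPart (B e x)) i j, fun e => ?_, fun e => ?_, fun x => ?_,
    fun ρ => ?_⟩
  · filter_upwards [c1 e, hB e] with x hx hx'
    rw [hx, ← hx', symPart_of_isSymm (hsymm e x)]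
  · have hm : AEStronglyMeasurable (fun x => B e x) μ :=
      aestronglyMeasurable_pi_of_apply fun k => aestronglyMeasurable_pi_of_apply fun l => d2 k l e
    exact ((hcont.matrix_elem i j).comp_aestronglyMeasurable ((c2 e).prodMk hm))
  · have : Continuous fun e => B e x := continuous_matrix fun k l => d3 k l x
    exact (hcont.matrix_elem i j).comp ((c3 x).prodMk this)
  · choose G hG hGb using fun k l => d4 k l ρ
    choose K hK0 hK using fun k l => exists_ae_le_of_memLp_top (hG k l)
    obtain ⟨M, hM⟩ := h.exists_stress_bound (∑ k, ∑ l, K k l)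
    refine ⟨fun _ => M, memLp_top_const M, fun e he => ?_⟩
    filter_upwards [hB e, Filter.eventually_all.2 fun k => Filter.eventually_all.2 fun l =>
        (hGb k l e he).and (hK k l)] with x hx hx'
    rw [← hx, symPart_of_isSymm (hsymm e x)]
    refine hM _ _ (hsymm e x) ((tnorm_le_sum_abs _).trans ?_) i j
    refine Finset.sum_le_sum fun k _ => Finset.sum_le_sum fun l _ => ?_
    rw [hx]
    exact (hx' k l).1.trans (hx' k l).2

theorem dominatedFamily_flux (hC : DominatedFamily 1 μ C)
    (hg : ∀ i, DominatedFamily 1 μ fun e x => g e x i)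
    (hD : ∀ i j, DominatedFamily ∞ μ fun e x => D e x i j) (hsymm : ∀ e x, (D e x).IsSymm)
    (i : Fin d) : DominatedFamily 1 μ fun e x => q (C e x) (g e x) (D e x) i := by
  obtain ⟨C', c1, c2, c3, -⟩ := hC
  choose D' d1 d2 d3 d4 using hD
  choose g' g1 g2 g3 g4 using hg
  set B : E → X → Ten d := fun e x => Matrix.of fun k l => D' k l e x
  set γ : E → X → Vec d := fun e x => WithLp.toLp 2 fun k => g' k e x
  have hB : ∀ e, D e =ᵐ[μ] fun x => B e x := fun e => by
    filter_upwards [Filter.eventually_all.2 fun k => Filter.eventually_all.2 fun l => d1 k l e]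
      with x hx
    ext k l
    exact hx k l
  have hγ : ∀ e, g e =ᵐ[μ] fun x => γ e x := fun e => by
    filter_upwards [Filter.eventually_all.2 fun k => g1 k e] with x hx
    ext k
    exact hx k
  have hcont : Continuous fun z : ℝ × Vec d × Ten d => q z.1 z.2.1 (symPart z.2.2) i :=
    (EuclideanSpace.proj i : Vec d →L[ℝ] ℝ).continuous.comp h.continuous_flux_symPart
  refine ⟨fun e x => q (C' e x) (γ e x) (symPart (B e x)) i, fun e => ?_, fun e => ?_, fun x => ?_,
    fun ρ => ?_⟩
  · filter_upwards [c1 e, hB e, hγ e] with x hx hx' hx''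
    rw [hx, hx'', ← hx', symPart_of_isSymm (hsymm e x)]
  · have hm : AEStronglyMeasurable (fun x => B e x) μ :=
      aestronglyMeasurable_pi_of_apply fun k => aestronglyMeasurable_pi_of_apply fun l => d2 k l e
    have hm' : AEStronglyMeasurable (fun x => γ e x) μ :=
      (PiLp.continuous_toLp 2 _).comp_aestronglyMeasurable
        (aestronglyMeasurable_pi_of_apply fun k => g2 k e)
    exact hcont.comp_aestronglyMeasurable ((c2 e).prodMk (hm'.prodMk hm))
  · have h1 : Continuous fun e => B e x := continuous_matrix fun k l => d3 k l x
    have h2 : Continuous fun e => γ e x :=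
      (PiLp.continuous_toLp 2 _).comp (continuous_pi fun k => g3 k x)
    exact hcont.comp ((c3 x).prodMk (h2.prodMk h1))
  · choose G hG hGb using fun k => g4 k ρ
    obtain ⟨C₄, h4, hgr⟩ := h.flux_growth
    refine ⟨fun x => C₄ * ∑ k, G k x, (memLp_finsetSum _ fun k _ => hG k).const_mul C₄,
      fun e he => ?_⟩
    filter_upwards [Filter.eventually_all.2 fun k => hGb k e he] with x hx
    refine (PiLp.norm_apply_le _ i).trans
      ((hgr _ (Set.mem_univ _) _ _ (isSymm_symPart _)).trans ?_)
    gcongr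
    rw [EuclideanSpace.norm_eq]
    refine Real.sqrt_le_iff.2 ⟨Finset.sum_nonneg fun k _ => (norm_nonneg _).trans (hx k), ?_⟩
    refine (Finset.sum_le_sum fun k _ => pow_le_pow_left₀ (norm_nonneg _) (hx k) 2).trans ?_
    exact Finset.sum_sq_le_sq_sum_of_nonneg fun k _ => (norm_nonneg _).trans (hx k)

end Families

end ConstitutiveLaws

/-! ### Parametrized scalar and vector fields -/

theorem weakGrad_add_ae_eq (hΩ : IsOpen Ω) {u v : Vec d → ℝ} (hu : ∃ g, HasWeakGrad Ω u g)
    (hv : ∃ g, HasWeakGrad Ω v g) :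
    weakGrad Ω (u + v) =ᵐ[volume.restrict Ω] weakGrad Ω u + weakGrad Ω v :=
  ((hasWeakGrad_weakGrad hu).add (hasWeakGrad_weakGrad hv)).weakGrad_ae_eq hΩ

theorem weakGrad_smul_ae_eq (hΩ : IsOpen Ω) {u : Vec d → ℝ} (hu : ∃ g, HasWeakGrad Ω u g) (a : ℝ) :
    weakGrad Ω (a • u) =ᵐ[volume.restrict Ω] a • weakGrad Ω u :=
  ((hasWeakGrad_weakGrad hu).smul a).weakGrad_ae_eq hΩ

theorem hasWeakGrad_zero : HasWeakGrad Ω (0 : Vec d → ℝ) 0 := by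
  refine ⟨(locallyIntegrable_zero).locallyIntegrableOn Ω, (locallyIntegrable_zero).locallyIntegrableOn Ω,
    fun φ _ _ _ i => ?_⟩
  simp

/-- A parametrized scalar field whose values and weak gradients form dominated families. -/
structure FieldFamily {E : Type*} [NormedAddCommGroup E] (p : ℝ≥0∞) (Ω : Set (Vec d))
    (u : E → Vec d → ℝ) : Prop where
  exists_grad : ∀ e, ∃ g, HasWeakGrad Ω (u e) g
  val : DominatedFamily p (volume.restrict Ω) u
  grad : ∀ i, DominatedFamily p (volume.restrict Ω) fun e x => weakGrad Ω (u e) x i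

namespace FieldFamily

variable {E : Type*} [NormedAddCommGroup E] {p : ℝ≥0∞}

theorem of_lipZero (hΩ : IsOpen Ω) (hb : Bornology.IsBounded Ω) {u : Vec d → ℝ}
    (hu : LipZero Ω u) : FieldFamily ∞ Ω fun _ : E => u := by
  have hex : ∃ g, HasWeakGrad Ω u g := ⟨_, hu.hasWeakGrad hΩ⟩
  refine ⟨fun _ => hex, .of_memLp ?_, fun i => .of_memLp ?_⟩
  · obtain ⟨C, -, hC⟩ := hu.exists_bound hb
    exact memLp_top_of_bound hu.continuous.aestronglyMeasurable C (.of_forall hC)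
  · obtain ⟨L, -, hL⟩ := hu.exists_bound_weakGrad hΩ
    exact memLp_top_of_bound ((EuclideanSpace.proj i : Vec d →L[ℝ] ℝ).continuous.comp_aestronglyMeasurable
      (aestronglyMeasurable_weakGrad hex)) L (hL.mono fun x hx => hx i)

theorem of_memW1 (hb : Bornology.IsBounded Ω) {u : Vec d → ℝ} {p : ℝ≥0∞} (hp : 1 ≤ p)
    (hu : MemW1 p Ω u) : FieldFamily 1 Ω fun _ : E => u := by
  have : IsFiniteMeasure (volume.restrict Ω) := ⟨by simpa using hb.measure_lt_top⟩
  refine ⟨fun _ => hu.2.1, .of_memLp (hu.1.mono_exponent hp), fun i => .of_memLp ?_⟩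
  have h1 := memLp_one_iff_integrable.1 (hu.2.2.mono_exponent hp)
  exact memLp_one_iff_integrable.2 ((EuclideanSpace.proj i : Vec d →L[ℝ] ℝ).integrable_comp h1)

theorem add (hΩ : IsOpen Ω) {u v : E → Vec d → ℝ} (hu : FieldFamily p Ω u)
    (hv : FieldFamily p Ω v) : FieldFamily p Ω fun e => u e + v e := by
  refine ⟨fun e => ⟨_, (hasWeakGrad_weakGrad (hu.exists_grad e)).add
    (hasWeakGrad_weakGrad (hv.exists_grad e))⟩, hu.val.add hv.val, fun i =>
    ((hu.grad i).add (hv.grad i)).congr fun e => ?_⟩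
  filter_upwards [weakGrad_add_ae_eq hΩ (hu.exists_grad e) (hv.exists_grad e)] with x hx
  rw [hx]; rfl

theorem smul [ProperSpace E] (hΩ : IsOpen Ω) {u : E → Vec d → ℝ} (hu : FieldFamily p Ω u)
    {a : E → ℝ} (ha : Continuous a) : FieldFamily p Ω fun e => a e • u e := by
  refine ⟨fun e => ⟨_, (hasWeakGrad_weakGrad (hu.exists_grad e)).smul (a e)⟩,
    (DominatedFamily.of_continuous ha).mul hu.val, fun i =>
    ((DominatedFamily.of_continuous ha).mul (hu.grad i)).congr fun e => ?_⟩
  filter_upwards [weakGrad_smul_ae_eq hΩ (hu.exists_grad e) (a e)] with x hx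
  rw [hx]; rfl

theorem sum (hΩ : IsOpen Ω) {ι : Type*} (s : Finset ι) {u : ι → E → Vec d → ℝ}
    (hu : ∀ k, FieldFamily p Ω (u k)) : FieldFamily p Ω fun e => ∑ k ∈ s, u k e := by
  classical
  induction s using Finset.induction_on with
  | empty =>
    simp only [Finset.sum_empty]
    refine ⟨fun _ => ⟨0, hasWeakGrad_zero⟩, .of_memLp (f := 0) MemLp.zero, fun i =>
      (DominatedFamily.of_memLp (f := fun _ => (0 : ℝ)) MemLp.zero).congr fun e => ?_⟩
    filter_upwards [(hasWeakGrad_zero (Ω := Ω)).weakGrad_ae_eq hΩ] with x hx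
    rw [hx]; rfl
  | insert k s hk ih =>
    simp only [Finset.sum_insert hk]
    exact (hu k).add hΩ ih

theorem mono_exponent (hb : Bornology.IsBounded Ω) {u : E → Vec d → ℝ} (hu : FieldFamily ∞ Ω u) :
    FieldFamily 1 Ω u := by
  have : IsFiniteMeasure (volume.restrict Ω) := ⟨by simpa using hb.measure_lt_top⟩
  exact ⟨hu.exists_grad, hu.val.mono_exponent le_top, fun i => (hu.grad i).mono_exponent le_top⟩

end FieldFamily

/-- A parametrized vector field that is bounded together with its weak gradient. -/
def VelFamily {E : Type*} [NormedAddCommGroup E] (Ω : Set (Vec d)) (U : E → Vec d → Vec d) : Prop :=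
  ∀ j, FieldFamily ∞ Ω fun e x => U e x j

/-- Lipschitz vector fields that vanish off `Ω`. -/
def VecLipZero (Ω : Set (Vec d)) (v : Vec d → Vec d) : Prop := ∀ j, LipZero Ω fun x => v x j

theorem VecLipZero.velFamily {E : Type*} [NormedAddCommGroup E] (hΩ : IsOpen Ω)
    (hb : Bornology.IsBounded Ω) {v : Vec d → Vec d} (hv : VecLipZero Ω v) :
    VelFamily Ω fun _ : E => v := fun j => FieldFamily.of_lipZero hΩ hb (hv j)

theorem isSymm_symGrad (v : Vec d → Vec d) (x : Vec d) : (symGrad Ω v x).IsSymm :=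
  isSymm_symPart (gradT Ω v x)

theorem symGrad_apply (v : Vec d → Vec d) (x : Vec d) (i j : Fin d) :
    symGrad Ω v x i j = 1 / 2 * (gradT Ω v x i j + gradT Ω v x j i) := rfl

theorem gradT_add_ae_eq (hΩ : IsOpen Ω) {v w : Vec d → Vec d} (hv : VecLipZero Ω v)
    (hw : VecLipZero Ω w) :
    ∀ᵐ x ∂volume.restrict Ω, gradT Ω (v + w) x = gradT Ω v x + gradT Ω w x := by
  filter_upwards [Filter.eventually_all.2 fun j => weakGrad_add_ae_eq hΩ
    ⟨_, (hv j).hasWeakGrad hΩ⟩ ⟨_, (hw j).hasWeakGrad hΩ⟩] with x hx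
  ext i j
  exact congrArg (fun y : Vec d => y i) (hx j)

theorem gradT_smul_ae_eq (hΩ : IsOpen Ω) {v : Vec d → Vec d} (hv : VecLipZero Ω v) (a : ℝ) :
    ∀ᵐ x ∂volume.restrict Ω, gradT Ω (a • v) x = a • gradT Ω v x := by
  filter_upwards [Filter.eventually_all.2 fun j => weakGrad_smul_ae_eq hΩ
    ⟨_, (hv j).hasWeakGrad hΩ⟩ a] with x hx
  ext i j
  exact congrArg (fun y : Vec d => y i) (hx j)

theorem symGrad_eq_add {u v w : Vec d → Vec d} {x : Vec d}
    (h : gradT Ω u x = gradT Ω v x + gradT Ω w x) :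
    symGrad Ω u x = symGrad Ω v x + symGrad Ω w x := by
  ext i j
  simp only [symGrad_apply, Matrix.add_apply, h]
  ring

theorem symGrad_eq_smul {u v : Vec d → Vec d} {x : Vec d} {a : ℝ}
    (h : gradT Ω u x = a • gradT Ω v x) : symGrad Ω u x = a • symGrad Ω v x := by
  ext i j
  simp only [symGrad_apply, Matrix.smul_apply, h, smul_eq_mul]
  ring

theorem divW_eq_add {u v w : Vec d → Vec d} {x : Vec d}
    (h : gradT Ω u x = gradT Ω v x + gradT Ω w x) :
    divW Ω u x = divW Ω v x + divW Ω w x := by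
  simp only [divW, Matrix.add_apply, h, Finset.sum_add_distrib]

theorem divW_eq_smul {u v : Vec d → Vec d} {x : Vec d} {a : ℝ}
    (h : gradT Ω u x = a • gradT Ω v x) : divW Ω u x = a * divW Ω v x := by
  simp only [divW, Matrix.smul_apply, h, smul_eq_mul, Finset.mul_sum]

theorem tdot_add_right (A B C : Ten d) : tdot A (B + C) = tdot A B + tdot A C := by
  simp only [tdot, Matrix.add_apply, mul_add, Finset.sum_add_distrib]

theorem tdot_smul_right (A B : Ten d) (a : ℝ) : tdot A (a • B) = a * tdot A B := by
  simp only [tdot, Matrix.smul_apply, smul_eq_mul, Finset.mul_sum]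
  exact Finset.sum_congr rfl fun i _ => Finset.sum_congr rfl fun j _ => by ring

theorem tdot_tenProd_add (a b c : Vec d) (A : Ten d) :
    tdot (tenProd a (b + c)) A = tdot (tenProd a b) A + tdot (tenProd a c) A := by
  simp only [tdot, tenProd, PiLp.add_apply, mul_add, add_mul, Finset.sum_add_distrib]

theorem tdot_tenProd_smul (a b : Vec d) (A : Ten d) (t : ℝ) :
    tdot (tenProd a (t • b)) A = t * tdot (tenProd a b) A := by
  simp only [tdot, tenProd, PiLp.smul_apply, smul_eq_mul, Finset.mul_sum]
  exact Finset.sum_congr rfl fun i _ => Finset.sum_congr rfl fun j _ => by ring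

theorem inner_eq_sum (a b : Vec d) : inner ℝ a b = ∑ i, a i * b i := by
  rw [PiLp.inner_apply]
  exact Finset.sum_congr rfl fun i _ => by simp [mul_comm]

section Integrands

variable {E : Type*} [NormedAddCommGroup E]
  {S : ℝ → Ten d → Ten d} {q : ℝ → Vec d → Ten d → Vec d} {r : ℝ → ℝ} {rm rp : ℝ}
  {U V W : E → Vec d → Vec d} {C Z : E → Vec d → ℝ}

theorem VelFamily.gradT (hU : VelFamily Ω U) (i j : Fin d) :
    DominatedFamily ∞ (volume.restrict Ω) fun e x => gradT Ω (U e) x i j := (hU j).grad i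

theorem VelFamily.symGrad (hU : VelFamily Ω U) (i j : Fin d) :
    DominatedFamily ∞ (volume.restrict Ω) fun e x => symGrad Ω (U e) x i j :=
  ((hU.gradT i j).add (hU.gradT j i)).const_mul (1 / 2)

theorem VelFamily.divW (hU : VelFamily Ω U) :
    DominatedFamily ∞ (volume.restrict Ω) fun e x => divW Ω (U e) x :=
  .sum _ fun i _ => hU.gradT i i

theorem VelFamily.stress_work (hb : Bornology.IsBounded Ω)
    (h : ConstitutiveLaws Set.univ S q r rm rp) (hU : VelFamily Ω U) (hC : FieldFamily 1 Ω C)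
    (hV : VelFamily Ω V) : DominatedFamily 1 (volume.restrict Ω) fun e x =>
      tdot (S (C e x) (_root_.symGrad Ω (U e) x)) (_root_.symGrad Ω (V e) x) := by
  have : IsFiniteMeasure (volume.restrict Ω) := ⟨by simpa using hb.measure_lt_top⟩
  refine DominatedFamily.mono_exponent (p := ∞) ?_ le_top
  refine .sum _ fun i _ => .sum _ fun j _ => DominatedFamily.mul (p := ∞) (q := ∞) ?_ (hV.symGrad i j)
  exact h.dominatedFamily_stress hC.val hU.symGrad (fun e x => isSymm_symGrad _ _) i j

theorem VelFamily.convective (hb : Bornology.IsBounded Ω) (hU : VelFamily Ω U)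
    (hV : VelFamily Ω V) (hW : VelFamily Ω W) : DominatedFamily 1 (volume.restrict Ω) fun e x =>
      tdot (tenProd (U e x) (V e x)) (_root_.gradT Ω (W e) x) := by
  have : IsFiniteMeasure (volume.restrict Ω) := ⟨by simpa using hb.measure_lt_top⟩
  refine DominatedFamily.mono_exponent (p := ∞) ?_ le_top
  refine .sum _ fun i _ => .sum _ fun j _ => DominatedFamily.mul (p := ∞) (q := ∞) ?_ (hW.gradT i j)
  exact DominatedFamily.mul (p := ∞) (q := ∞) (hU i).val (hV j).val

theorem FieldFamily.flux_work (h : ConstitutiveLaws Set.univ S q r rm rp) (hU : VelFamily Ω U)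
    (hC : FieldFamily 1 Ω C) (hZ : FieldFamily ∞ Ω Z) :
    DominatedFamily 1 (volume.restrict Ω) fun e x =>
      inner ℝ (q (C e x) (weakGrad Ω (C e) x) (symGrad Ω (U e) x)) (weakGrad Ω (Z e) x) := by
  simp only [inner_eq_sum]
  refine .sum _ fun i _ => DominatedFamily.mul (p := 1) (q := ∞) ?_ (hZ.grad i)
  exact h.dominatedFamily_flux hC.val hC.grad hU.symGrad (fun e x => isSymm_symGrad _ _) i

theorem FieldFamily.transport_left (hU : VelFamily Ω U)
    (hC : FieldFamily 1 Ω C) (hZ : FieldFamily ∞ Ω Z) :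
    DominatedFamily 1 (volume.restrict Ω) fun e x =>
      Z e x * inner ℝ (U e x) (weakGrad Ω (C e) x) := by
  simp only [inner_eq_sum]
  refine DominatedFamily.mul (p := ∞) (q := 1) hZ.val ?_
  exact .sum _ fun i _ => DominatedFamily.mul (p := ∞) (q := 1) (hU i).val (hC.grad i)

theorem FieldFamily.transport_right (hU : VelFamily Ω U)
    (hC : FieldFamily 1 Ω C) (hZ : FieldFamily ∞ Ω Z) :
    DominatedFamily 1 (volume.restrict Ω) fun e x =>
      C e x * inner ℝ (U e x) (weakGrad Ω (Z e) x) := by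
  simp only [inner_eq_sum]
  refine DominatedFamily.mul (p := 1) (q := ∞) hC.val ?_
  exact .sum _ fun i _ => DominatedFamily.mul (p := ∞) (q := ∞) (hU i).val (hZ.grad i)

end Integrands

/-! ### Finite element spaces -/

theorem vecLipZero_of_mem_velSpace (hΩ : IsOpen Ω) {R : RefSpaces d} {G : Mesh Ω}
    {v : Vec d → Vec d} (hv : v ∈ velSpace R G) : VecLipZero Ω v := by
  obtain ⟨L, hL⟩ := G.exists_lipschitzWith hΩ hv.2.1 fun k => R.V_lip _ (hv.2.2 k)
  refine fun j => ⟨⟨L, LipschitzWith.of_dist_le_mul fun x y => ?_⟩, fun x hx => by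
    simp [hv.2.1 x hx]⟩
  refine le_trans ?_ (hL.dist_le_mul x y)
  rw [dist_eq_norm, dist_eq_norm]
  exact PiLp.norm_apply_le (v x - v y) j

theorem lipZero_of_mem_concSpace (hΩ : IsOpen Ω) {R : RefSpaces d} {G : Mesh Ω}
    {z : Vec d → ℝ} (hz : z ∈ concSpace R G) : LipZero Ω z :=
  ⟨G.exists_lipschitzWith hΩ hz.2.1 fun k => R.Z_lip _ (hz.2.2 k), hz.2.1⟩

/-- Functions that vanish off `Ω` and agree on all elements of a mesh are equal. -/
theorem Mesh.eq_of_comp_symm_eq {Y : Type*} [Zero Y] (G : Mesh Ω) {v w : Vec d → Y}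
    (hv : ∀ x, x ∉ Ω → v x = 0) (hw : ∀ x, x ∉ Ω → w x = 0)
    (h : ∀ k, ∀ y : refSimplex d, v ((G.F k).symm y) = w ((G.F k).symm y)) : v = w := by
  funext x
  by_cases hx : x ∈ Ω
  · obtain ⟨k, y, hy, rfl⟩ := G.exists_mem_elem hx
    exact h k ⟨y, hy⟩
  · rw [hv x hx, hw x hx]

instance finiteDimensional_velSpace (R : RefSpaces d) (G : Mesh Ω) :
    FiniteDimensional ℝ (velSpace R G) := by
  have := R.V_fin
  let T : velSpace R G →ₗ[ℝ] (Fin G.card → R.V) :=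
    { toFun := fun v k => ⟨fun y => v.1 ((G.F k).symm y), v.2.2.2 k⟩
      map_add' := fun _ _ => rfl
      map_smul' := fun _ _ => rfl }
  refine FiniteDimensional.of_injective T fun v w hvw => Subtype.ext ?_
  refine G.eq_of_comp_symm_eq v.2.2.1 w.2.2.1 fun k y => ?_
  exact congrFun (congrArg Subtype.val (congrFun hvw k)) y

instance finiteDimensional_concSpace (R : RefSpaces d) (G : Mesh Ω) :
    FiniteDimensional ℝ (concSpace R G) := by
  have := R.Z_fin
  let T : concSpace R G →ₗ[ℝ] (Fin G.card → R.Z) :=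
    { toFun := fun v k => ⟨fun y => v.1 ((G.F k).symm y), v.2.2.2 k⟩
      map_add' := fun _ _ => rfl
      map_smul' := fun _ _ => rfl }
  refine FiniteDimensional.of_injective T fun v w hvw => Subtype.ext ?_
  refine G.eq_of_comp_symm_eq v.2.2.1 w.2.2.1 fun k y => ?_
  exact congrFun (congrArg Subtype.val (congrFun hvw k)) y

/-! ### Residuals as linear functionals of the test function -/

theorem integral_add_of_ae {X : Type*} [MeasurableSpace X] {μ : Measure X} {F A B : X → ℝ}
    (hA : Integrable A μ) (hB : Integrable B μ) (h : ∀ᵐ x ∂μ, F x = A x + B x) :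
    ∫ x, F x ∂μ = ∫ x, A x ∂μ + ∫ x, B x ∂μ := by
  rw [integral_congr_ae h, integral_add hA hB]

theorem integral_const_mul_of_ae {X : Type*} [MeasurableSpace X] {μ : Measure X} {F A : X → ℝ}
    {a : ℝ} (h : ∀ᵐ x ∂μ, F x = a * A x) : ∫ x, F x ∂μ = a * ∫ x, A x ∂μ := by
  rw [integral_congr_ae h, integral_const_mul]

section Functionals

variable {S : ℝ → Ten d → Ten d} {q : ℝ → Vec d → Ten d → Vec d} {r : ℝ → ℝ} {rm rp : ℝ}
  {p : ℝ≥0∞} {R : RefSpaces d} {G : Mesh Ω}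

/-- A bounded functional on `W₀^{1,p}` restricts to a linear functional on the velocity space. -/
theorem exists_linearMap_of_isDual (hΩ : IsOpen Ω) (hb : Bornology.IsBounded Ω)
    {f : (Vec d → Vec d) → ℝ} (hf : IsDualW10Vec p Ω f) (R : RefSpaces d) (G : Mesh Ω) :
    ∃ φ : velSpace R G →ₗ[ℝ] ℝ, ∀ V, φ V = f V := by
  have hmem : ∀ V : velSpace R G, MemW10Vec p Ω V := fun V j =>
    (vecLipZero_of_mem_velSpace hΩ V.2 j).memW10 hΩ hb p
  exact ⟨{ toFun := fun V => f V
           map_add' := fun V W => hf.1 _ _ (hmem V) (hmem W)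
           map_smul' := fun a V => hf.2.1 a _ (hmem V) }, fun _ => rfl⟩

/-- The residual of the momentum equation is linear in the test function. -/
theorem exists_momentum_functional (hΩ : IsOpen Ω) (hb : Bornology.IsBounded Ω)
    (h : ConstitutiveLaws Set.univ S q r rm rp) {f : (Vec d → Vec d) → ℝ}
    (hf : IsDualW10Vec p Ω f) (R : RefSpaces d) (G : Mesh Ω) {U : Vec d → Vec d} {C : Vec d → ℝ}
    (hU : VecLipZero Ω U) (hC : FieldFamily 1 Ω fun _ : Unit => C) :
    ∃ ℓ : velSpace R G →ₗ[ℝ] ℝ, ∀ V, ℓ V =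
      (∫ x in Ω, tdot (S (C x) (symGrad Ω U x)) (symGrad Ω V x)) + formBu Ω U U V - f V := by
  obtain ⟨φ, hφ⟩ := exists_linearMap_of_isDual hΩ hb hf R G
  have hlip : ∀ V : velSpace R G, VecLipZero Ω V := fun V => vecLipZero_of_mem_velSpace hΩ V.2
  have hUf : VelFamily Ω fun _ : Unit => U := hU.velFamily hΩ hb
  have hf1 : ∀ V : velSpace R G, VelFamily Ω fun _ : Unit => (V : Vec d → Vec d) := fun V =>
    (hlip V).velFamily hΩ hb
  have i1 := fun V => (VelFamily.stress_work hb h hUf hC (hf1 V)).integrable ()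
  have i2 := fun V => ((VelFamily.convective hb hUf (hf1 V) hUf).sub
    (VelFamily.convective hb hUf hUf (hf1 V))).integrable ()
  refine ⟨⟨⟨fun V => (∫ x in Ω, tdot (S (C x) (symGrad Ω U x)) (symGrad Ω V x))
    + formBu Ω U U V - φ V, fun V W => ?_⟩, fun a V => ?_⟩, fun V => by simp [hφ]⟩
  · have e1 := integral_add_of_ae (F := fun x => tdot (S (C x) (symGrad Ω U x))
      (symGrad Ω ((V : Vec d → Vec d) + W) x)) (i1 V) (i1 W) (by
        filter_upwards [gradT_add_ae_eq hΩ (hlip V) (hlip W)] with x hx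
        rw [symGrad_eq_add hx, tdot_add_right])
    have e2 : formBu Ω U U ((V : Vec d → Vec d) + W) = formBu Ω U U V + formBu Ω U U W := by
      rw [formBu, formBu, formBu, integral_add_of_ae (i2 V) (i2 W), mul_add]
      filter_upwards [gradT_add_ae_eq hΩ (hlip V) (hlip W)] with x hx
      rw [hx, tdot_add_right, Pi.add_apply, tdot_tenProd_add]
      ring
    simp only [Submodule.coe_add, map_add, e1, e2]
    ring
  · have e1 := integral_const_mul_of_ae (μ := volume.restrict Ω)
      (F := fun x => tdot (S (C x) (symGrad Ω U x)) (symGrad Ω (a • (V : Vec d → Vec d)) x))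
      (A := fun x => tdot (S (C x) (symGrad Ω U x)) (symGrad Ω V x)) (a := a) (by
        filter_upwards [gradT_smul_ae_eq hΩ (hlip V) a] with x hx
        rw [symGrad_eq_smul hx, tdot_smul_right])
    have e2 : formBu Ω U U (a • (V : Vec d → Vec d)) = a * formBu Ω U U V := by
      rw [formBu, formBu, mul_left_comm]
      congr 1
      refine integral_const_mul_of_ae ?_
      filter_upwards [gradT_smul_ae_eq hΩ (hlip V) a] with x hx
      rw [hx, tdot_smul_right, Pi.smul_apply, tdot_tenProd_smul]
      ring
    simp only [Submodule.coe_smul, map_smul, e1, e2, RingHom.id_apply, smul_eq_mul]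
    ring

/-- The residual of the concentration equation is linear in the test function. -/
theorem exists_concentration_functional (hΩ : IsOpen Ω) (hb : Bornology.IsBounded Ω)
    (h : ConstitutiveLaws Set.univ S q r rm rp) (R : RefSpaces d) (G : Mesh Ω)
    {U : Vec d → Vec d} {C : Vec d → ℝ}
    (hU : VecLipZero Ω U) (hC : FieldFamily 1 Ω fun _ : Unit => C) :
    ∃ κ : concSpace R G →ₗ[ℝ] ℝ, ∀ Z, κ Z =
      (∫ x in Ω, inner ℝ (q (C x) (weakGrad Ω C x) (symGrad Ω U x)) (weakGrad Ω Z x))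
        + formBc Ω C U Z := by
  have hlip : ∀ Z : concSpace R G, LipZero Ω Z := fun Z => lipZero_of_mem_concSpace hΩ Z.2
  have hex : ∀ Z : concSpace R G, ∃ g, HasWeakGrad Ω Z g := fun Z => ⟨_, (hlip Z).hasWeakGrad hΩ⟩
  have hUf : VelFamily Ω fun _ : Unit => U := hU.velFamily hΩ hb
  have hf1 : ∀ Z : concSpace R G, FieldFamily ∞ Ω fun _ : Unit => (Z : Vec d → ℝ) := fun Z =>
    .of_lipZero hΩ hb (hlip Z)
  have i1 := fun Z => (FieldFamily.flux_work h hUf hC (hf1 Z)).integrable ()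
  have i2 := fun Z => ((FieldFamily.transport_left hUf hC (hf1 Z)).sub
    (FieldFamily.transport_right hUf hC (hf1 Z))).integrable ()
  refine ⟨⟨⟨fun Z => (∫ x in Ω, inner ℝ (q (C x) (weakGrad Ω C x) (symGrad Ω U x))
    (weakGrad Ω Z x)) + formBc Ω C U Z, fun V W => ?_⟩, fun a V => ?_⟩, fun V => rfl⟩
  · have e1 := integral_add_of_ae (F := fun x => inner ℝ
      (q (C x) (weakGrad Ω C x) (symGrad Ω U x)) (weakGrad Ω ((V : Vec d → ℝ) + W) x))
      (i1 V) (i1 W) (by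
        filter_upwards [weakGrad_add_ae_eq hΩ (hex V) (hex W)] with x hx
        rw [hx, Pi.add_apply, inner_add_right])
    have e2 : formBc Ω C U ((V : Vec d → ℝ) + W) = formBc Ω C U V + formBc Ω C U W := by
      rw [formBc, formBc, formBc, integral_add_of_ae (i2 V) (i2 W), mul_add]
      filter_upwards [weakGrad_add_ae_eq hΩ (hex V) (hex W)] with x hx
      rw [hx, Pi.add_apply, Pi.add_apply, inner_add_right]
      ring
    simp only [Submodule.coe_add, e1, e2]
    ring
  · have e1 := integral_const_mul_of_ae (μ := volume.restrict Ω) (F := fun x => inner ℝ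
      (q (C x) (weakGrad Ω C x) (symGrad Ω U x)) (weakGrad Ω (a • (V : Vec d → ℝ)) x))
      (A := fun x => inner ℝ (q (C x) (weakGrad Ω C x) (symGrad Ω U x)) (weakGrad Ω V x))
      (a := a) (by
        filter_upwards [weakGrad_smul_ae_eq hΩ (hex V) a] with x hx
        rw [hx, Pi.smul_apply, inner_smul_right])
    have e2 : formBc Ω C U (a • (V : Vec d → ℝ)) = a * formBc Ω C U V := by
      rw [formBc, formBc, mul_left_comm]
      congr 1
      refine integral_const_mul_of_ae ?_
      filter_upwards [weakGrad_smul_ae_eq hΩ (hex V) a] with x hx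
      rw [hx, Pi.smul_apply, Pi.smul_apply, inner_smul_right, smul_eq_mul]
      ring
    simp only [Submodule.coe_smul, e1, e2, RingHom.id_apply, smul_eq_mul]
    ring

theorem integrable_divW_mul (hΩ : IsOpen Ω) (hb : Bornology.IsBounded Ω) {V : Vec d → Vec d}
    (hV : VecLipZero Ω V) (P : Lp ℝ ∞ (volume.restrict Ω)) :
    Integrable (fun x => divW Ω V x * P x) (volume.restrict Ω) := by
  have : IsFiniteMeasure (volume.restrict Ω) := ⟨by simpa using hb.measure_lt_top⟩
  have h1 : DominatedFamily ∞ (volume.restrict Ω) fun _ : Unit => divW Ω V :=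
    (hV.velFamily hΩ hb).divW
  have h2 := h1.mul (s := ∞) (DominatedFamily.of_memLp (E := Unit) (Lp.memLp P))
  exact (h2.mono_exponent le_top).integrable ()

/-- The pairing of pressures with divergences of velocities. -/
theorem exists_divergence_pairing (hΩ : IsOpen Ω) (hb : Bornology.IsBounded Ω) (R : RefSpaces d)
    (G : Mesh Ω) : ∃ β : presSpace R G →ₗ[ℝ] Module.Dual ℝ (velSpace R G),
      ∀ P V, β P V = ∫ x in Ω, divW Ω V x * (P : Lp ℝ ∞ (volume.restrict Ω)) x := by
  have hlip : ∀ V : velSpace R G, VecLipZero Ω V := fun V => vecLipZero_of_mem_velSpace hΩ V.2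
  have hi := fun (P : presSpace R G) (V : velSpace R G) =>
    integrable_divW_mul hΩ hb (hlip V) (P : Lp ℝ ∞ (volume.restrict Ω))
  refine ⟨LinearMap.mk₂ ℝ (fun P V => ∫ x in Ω, divW Ω V x * (P : Lp ℝ ∞ (volume.restrict Ω)) x)
    (fun P Q V => ?_) (fun a P V => ?_) (fun P V W => ?_) (fun a P V => ?_), fun P V => rfl⟩
  · refine integral_add_of_ae (hi P V) (hi Q V) ?_
    filter_upwards [Lp.coeFn_add (P : Lp ℝ ∞ (volume.restrict Ω)) Q] with x hx
    rw [Submodule.coe_add, hx, Pi.add_apply, mul_add]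
  · refine integral_const_mul_of_ae ?_
    filter_upwards [Lp.coeFn_smul a (P : Lp ℝ ∞ (volume.restrict Ω))] with x hx
    rw [Submodule.coe_smul, hx, Pi.smul_apply, smul_eq_mul]
    ring
  · refine integral_add_of_ae (hi P V) (hi P W) ?_
    filter_upwards [gradT_add_ae_eq hΩ (hlip V) (hlip W)] with x hx
    rw [Submodule.coe_add, divW_eq_add hx, add_mul]
  · refine integral_const_mul_of_ae ?_
    filter_upwards [gradT_smul_ae_eq hΩ (hlip V) a] with x hx
    rw [Submodule.coe_smul, divW_eq_smul hx, mul_assoc]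

theorem LipZero.integral_weakGrad_eq_zero (hΩ : IsOpen Ω) (hb : Bornology.IsBounded Ω)
    {u : Vec d → ℝ} (hu : LipZero Ω u) (i : Fin d) : ∫ x in Ω, weakGrad Ω u x i = 0 := by
  obtain ⟨L, hL⟩ := hu.lip
  set e : Vec d := EuclideanSpace.single i (1 : ℝ)
  have h1 := LipschitzWith.integral_lineDeriv_mul_eq (μ := volume)
    (LipschitzWith.const (1 : ℝ) : LipschitzWith 0 fun _ : Vec d => (1 : ℝ)) hL
    (hu.hasCompactSupport hb) e
  have h0 : ∀ x, lineDeriv ℝ (fun _ : Vec d => (1 : ℝ)) x e = 0 := fun x => by simp [lineDeriv]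
  simp only [h0, zero_mul, integral_zero, mul_one, lineDeriv_neg, integral_neg] at h1
  have h2 : ∫ x in Ω, weakGrad Ω u x i = ∫ x in Ω, lineDeriv ℝ u x e := by
    refine integral_congr_ae ?_
    filter_upwards [hu.weakGrad_ae_eq hΩ] with x hx
    rw [hx]; rfl
  rw [h2, setIntegral_eq_integral_of_ae_compl_eq_zero (hu.ae_lineDeriv_eq_zero hΩ e)]
  linarith

theorem VecLipZero.integral_divW_eq_zero (hΩ : IsOpen Ω) (hb : Bornology.IsBounded Ω)
    {v : Vec d → Vec d} (hv : VecLipZero Ω v) : ∫ x in Ω, divW Ω v x = 0 := by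
  have : IsFiniteMeasure (volume.restrict Ω) := ⟨by simpa using hb.measure_lt_top⟩
  unfold divW
  rw [integral_finsetSum]
  · exact Finset.sum_eq_zero fun i _ => (hv i).integral_weakGrad_eq_zero hΩ hb i
  · intro i _
    have h1 : VelFamily Ω fun _ : Unit => v := hv.velFamily hΩ hb
    exact ((h1.gradT i i).mono_exponent le_top).integrable ()

/-- Every solution of the divergence-free problem is completed by a discrete pressure: the momentum
residual annihilates the kernel of the divergence pairing, so in finite dimension it is represented
by a pressure, from which the mean value can be subtracted. -/
theorem SolvesDivFree.exists_solvesMixed (hΩ : IsOpen Ω) (hb : Bornology.IsBounded Ω)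
    (h : ConstitutiveLaws Set.univ S q r rm rp) {f : (Vec d → Vec d) → ℝ}
    (hf : IsDualW10Vec p Ω f) {c_d : Vec d → ℝ} {s : ℝ≥0∞} (hs : 1 ≤ s) (hc : MemW1 s Ω c_d)
    (hG : ContainsPiecewiseConst R G) {U : Vec d → Vec d} {C : Vec d → ℝ}
    (hUC : SolvesDivFree R G S q f c_d U C) : ∃ P, SolvesMixed R G S q f c_d U P C := by
  have : IsFiniteMeasure (volume.restrict Ω) := ⟨by simpa using hb.measure_lt_top⟩
  obtain ⟨hU, hC, hmom, hconc⟩ := hUC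
  have hCf : FieldFamily 1 Ω fun _ : Unit => C := by
    have h1 : FieldFamily 1 Ω fun _ : Unit => C - c_d :=
      (FieldFamily.of_lipZero hΩ hb (lipZero_of_mem_concSpace hΩ hC)).mono_exponent hb
    have h2 := h1.add hΩ (FieldFamily.of_memW1 hb hs hc)
    simpa using h2
  obtain ⟨ℓ, hℓ⟩ := exists_momentum_functional hΩ hb h hf R G
    (vecLipZero_of_mem_velSpace hΩ hU.1) hCf
  obtain ⟨β, hβ⟩ := exists_divergence_pairing hΩ hb R G
  have hfin : FiniteDimensional ℝ (Module.Dual ℝ (velSpace R G)) := inferInstance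
  have hfin' : FiniteDimensional ℝ (LinearMap.range β) :=
    FiniteDimensional.finiteDimensional_submodule _
  have hmem : ℓ ∈ LinearMap.range β := by
    rw [← Subspace.dualCoannihilator_dualAnnihilator_eq (W := LinearMap.range β),
      Submodule.mem_dualAnnihilator]
    intro V hV
    rw [Submodule.mem_dualCoannihilator] at hV
    rw [hℓ, hmom V ⟨V.2, fun P hP => ?_⟩, sub_self]
    rw [← hβ ⟨P, hP⟩ V]
    exact hV _ ⟨_, rfl⟩
  obtain ⟨P, hP⟩ := hmem
  set m : ℝ := (∫ x in Ω, (P : Lp ℝ ∞ (volume.restrict Ω)) x) / (volume.restrict Ω).real Set.univ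
  set one : Lp ℝ ∞ (volume.restrict Ω) := (memLp_const (1 : ℝ)).toLp _
  have hone : ∀ᵐ x ∂volume.restrict Ω, one x = 1 := MemLp.coeFn_toLp _
  have honemem : one ∈ presSpace R G := hG _ fun k => ⟨1, ae_elem_of_ae hone⟩
  have hsub : ∀ᵐ x ∂volume.restrict Ω, ((P : Lp ℝ ∞ (volume.restrict Ω)) - m • one) x
      = (P : Lp ℝ ∞ (volume.restrict Ω)) x - m := by
    filter_upwards [Lp.coeFn_sub (P : Lp ℝ ∞ (volume.restrict Ω)) (m • one),
      Lp.coeFn_smul m one, hone] with x h1 h2 h3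
    rw [h1, Pi.sub_apply, h2, Pi.smul_apply, h3, smul_eq_mul, mul_one]
  have hPint : Integrable (P : Lp ℝ ∞ (volume.restrict Ω)) (volume.restrict Ω) :=
    (Lp.memLp _).integrable le_top
  refine ⟨P - m • one, hU.1, ⟨Submodule.sub_mem _ P.2 (Submodule.smul_mem _ _ honemem), ?_⟩, hC,
    fun V hV => ?_, fun Q hQ => ?_, hconc⟩
  · rw [integral_congr_ae hsub, integral_sub hPint (integrable_const _), integral_const,
      smul_eq_mul]
    -- for empty `Ω` the mean value is the junk quotient `0 / 0`, but then all integrals vanish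
    rcases eq_or_ne ((volume.restrict Ω).real Set.univ) 0 with h0 | h0
    · have hμ : volume Ω = 0 := by
        rw [Measure.real, ENNReal.toReal_eq_zero_iff] at h0
        simpa using h0.resolve_right (measure_ne_top _ _)
      rw [setIntegral_measure_zero _ hμ, h0, zero_mul, sub_zero]
    · rw [mul_div_cancel₀ _ h0, sub_self]
  · have hlip := vecLipZero_of_mem_velSpace hΩ hV
    have h1 : ∫ x in Ω, divW Ω V x * ((P : Lp ℝ ∞ (volume.restrict Ω)) - m • one) x = ℓ ⟨V, hV⟩ := by
      have h2 : Integrable (fun x => m * divW Ω V x) (volume.restrict Ω) :=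
        ((DominatedFamily.mono_exponent (VelFamily.divW (hlip.velFamily (E := Unit) hΩ hb))
          le_top).integrable ()).const_mul m
      have h3 := integral_sub
        (integrable_divW_mul hΩ hb hlip (P : Lp ℝ ∞ (volume.restrict Ω))) h2
      rw [integral_const_mul, hlip.integral_divW_eq_zero hΩ hb, mul_zero, sub_zero] at h3
      rw [← hP, hβ, ← h3]
      refine integral_congr_ae ?_
      filter_upwards [hsub] with x hx
      rw [hx]
      ring
    rw [h1, hℓ]
    ring
  · rw [← hU.2 Q hQ]
    exact integral_congr_ae (.of_forall fun x => mul_comm _ _)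

end Functionals

/-! ### Coercivity and existence for the divergence-free problem -/

/-- A continuous, absolutely homogeneous, positive function on a finite-dimensional space dominates
a multiple of the norm. -/
theorem exists_pos_mul_norm_le {E : Type*} [NormedAddCommGroup E] [NormedSpace ℝ E]
    [FiniteDimensional ℝ E] {N : E → ℝ} (hc : Continuous N) (hh : ∀ (a : ℝ) u, N (a • u) = |a| * N u)
    (hp : ∀ u, u ≠ 0 → 0 < N u) : ∃ m > 0, ∀ u, m * ‖u‖ ≤ N u := by
  have h0 : N 0 = 0 := by simpa using hh 0 0
  rcases (Metric.sphere (0 : E) 1).eq_empty_or_nonempty with hs | hs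
  · refine ⟨1, one_pos, fun u => ?_⟩
    rcases eq_or_ne u 0 with rfl | hu
    · simp [h0]
    · have : ‖u‖⁻¹ • u ∈ Metric.sphere (0 : E) 1 := by
        simp [norm_smul, inv_mul_cancel₀ (norm_ne_zero_iff.2 hu)]
      simp [hs] at this
  · obtain ⟨v, hv, hmin⟩ := (isCompact_sphere (0 : E) 1).exists_isMinOn hs hc.continuousOn
    have hv0 : v ≠ 0 := by
      rintro rfl
      simp at hv
    refine ⟨N v, hp v hv0, fun u => ?_⟩
    rcases eq_or_ne u 0 with rfl | hu
    · simp [h0]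
    · have hu' : 0 < ‖u‖ := norm_pos_iff.2 hu
      have h1 : ‖u‖⁻¹ • u ∈ Metric.sphere (0 : E) 1 := by
        simp [norm_smul, inv_mul_cancel₀ hu'.ne']
      have h2 : N v ≤ N (‖u‖⁻¹ • u) := hmin h1
      rw [hh, abs_of_pos (inv_pos.2 hu'), inv_mul_eq_div, le_div_iff₀ hu'] at h2
      exact h2

/-- A bounded family that depends homogeneously on the parameter is bounded by a multiple of the
norm of the parameter. -/
theorem DominatedFamily.exists_bound_mul_norm {X E : Type*} [MeasurableSpace X]
    [NormedAddCommGroup E] [NormedSpace ℝ E] {μ : Measure X} {F : E → X → ℝ}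
    (hF : DominatedFamily ∞ μ F) (hh : ∀ (a : ℝ) e, ∀ᵐ x ∂μ, F (a • e) x = a * F e x) :
    ∃ K : ℝ, 0 ≤ K ∧ ∀ e, ∀ᵐ x ∂μ, |F e x| ≤ K * ‖e‖ := by
  obtain ⟨F', h1, -, -, h4⟩ := hF
  obtain ⟨g, hg, hb⟩ := h4 1
  obtain ⟨K, hK0, hK⟩ := exists_ae_le_of_memLp_top hg
  refine ⟨K, hK0, fun e => ?_⟩
  rcases eq_or_ne e 0 with rfl | he
  · filter_upwards [hh 0 0] with x hx
    simp only [smul_zero, zero_mul] at hx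
    simp [hx]
  · have he' : 0 < ‖e‖ := norm_pos_iff.2 he
    have hn : ‖‖e‖⁻¹ • e‖ ≤ 1 := by simp [norm_smul, inv_mul_cancel₀ he'.ne']
    filter_upwards [hh ‖e‖⁻¹ e, h1 (‖e‖⁻¹ • e), hb _ hn, hK] with x k1 k2 k3 k4
    rw [← k2, k1, norm_mul, norm_inv, norm_norm, inv_mul_eq_div, div_le_iff₀ he',
      Real.norm_eq_abs] at k3
    exact k3.trans (mul_le_mul_of_nonneg_right k4 he'.le)

theorem EuclideanSpace.sum_smul_single {N : ℕ} (u : EuclideanSpace ℝ (Fin N)) :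
    u = ∑ k, u k • EuclideanSpace.single k (1 : ℝ) := by
  have := (EuclideanSpace.basisFun (Fin N) ℝ).sum_repr u
  simpa using this.symm

theorem inner_toLp_linearMap {N : ℕ} (ℓ : EuclideanSpace ℝ (Fin N) →ₗ[ℝ] ℝ)
    (u : EuclideanSpace ℝ (Fin N)) :
    inner ℝ (WithLp.toLp 2 fun k => ℓ (EuclideanSpace.single k (1 : ℝ)) : EuclideanSpace ℝ (Fin N)) u
      = ℓ u := by
  nth_rewrite 2 [EuclideanSpace.sum_smul_single u]
  rw [inner_eq_sum, map_sum]
  refine Finset.sum_congr rfl fun k _ => ?_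
  rw [map_smul, smul_eq_mul, mul_comm]

section Existence

variable {S : ℝ → Ten d → Ten d} {q : ℝ → Vec d → Ten d → Vec d} {r : ℝ → ℝ} {rm rp : ℝ}
  {p : ℝ≥0∞} {R : RefSpaces d} {G : Mesh Ω} {N : ℕ}

/-- Finite element velocities that depend linearly on coordinates form a bounded family. -/
theorem velFamily_of_linearMap {E : Type*} [NormedAddCommGroup E] [ProperSpace E] (hΩ : IsOpen Ω)
    (hb : Bornology.IsBounded Ω) (φ : EuclideanSpace ℝ (Fin N) →ₗ[ℝ] velSpace R G)
    {π : E → EuclideanSpace ℝ (Fin N)} (hπ : Continuous π) :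
    VelFamily Ω fun e => (φ (π e) : Vec d → Vec d) := by
  intro j
  have h1 : (fun (e : E) (x : Vec d) => (φ (π e) : Vec d → Vec d) x j) = fun e =>
      ∑ k, (π e k) • fun x => (φ (EuclideanSpace.single k 1) : Vec d → Vec d) x j := by
    funext e x
    conv_lhs => rw [EuclideanSpace.sum_smul_single (π e)]
    simp [map_sum]
  rw [h1]
  refine FieldFamily.sum hΩ _ fun k => FieldFamily.smul hΩ ?_ (by fun_prop)
  exact FieldFamily.of_lipZero hΩ hb (vecLipZero_of_mem_velSpace hΩ (φ _).2 j)

/-- Finite element concentrations that depend linearly on coordinates form a bounded family. -/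
theorem fieldFamily_of_linearMap {E : Type*} [NormedAddCommGroup E] [ProperSpace E] (hΩ : IsOpen Ω)
    (hb : Bornology.IsBounded Ω) (ψ : EuclideanSpace ℝ (Fin N) →ₗ[ℝ] concSpace R G)
    {π : E → EuclideanSpace ℝ (Fin N)} (hπ : Continuous π) :
    FieldFamily ∞ Ω fun e => (ψ (π e) : Vec d → ℝ) := by
  have h1 : (fun e : E => (ψ (π e) : Vec d → ℝ)) = fun e =>
      ∑ k, (π e k) • (ψ (EuclideanSpace.single k 1) : Vec d → ℝ) := by
    funext e
    conv_lhs => rw [EuclideanSpace.sum_smul_single (π e)]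
    simp [map_sum]
  rw [h1]
  refine FieldFamily.sum hΩ _ fun k => FieldFamily.smul hΩ ?_ (by fun_prop)
  exact FieldFamily.of_lipZero hΩ hb (lipZero_of_mem_concSpace hΩ (ψ _).2)

/-- A discrete Korn inequality: the `L¹` norm of the diagonal of the velocity gradient controls the
coordinates of a finite element velocity. -/
theorem exists_korn_constant (hΩ : IsOpen Ω) (hb : Bornology.IsBounded Ω)
    {φ : EuclideanSpace ℝ (Fin N) →ₗ[ℝ] velSpace R G} (hφ : Function.Injective φ) :
    ∃ m > 0, ∀ u, m * ‖u‖ ≤ ∫ x in Ω, ∑ i, |gradT Ω (φ u) x i i| := by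
  have : IsFiniteMeasure (volume.restrict Ω) := ⟨by simpa using hb.measure_lt_top⟩
  have hfam := velFamily_of_linearMap hΩ hb φ continuous_id
  have hdom : DominatedFamily 1 (volume.restrict Ω) fun u x => ∑ i, |gradT Ω (φ u) x i i| :=
    DominatedFamily.mono_exponent (p := ∞) (.sum _ fun i _ => (hfam.gradT i i).abs) le_top
  have hlip : ∀ u, VecLipZero Ω (φ u) := fun u => vecLipZero_of_mem_velSpace hΩ (φ u).2
  refine exists_pos_mul_norm_le hdom.continuous_integral (fun a u => ?_) fun u hu => ?_
  · refine integral_const_mul_of_ae ?_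
    filter_upwards [gradT_smul_ae_eq hΩ (hlip u) a] with x hx
    rw [map_smul, Submodule.coe_smul, hx, Finset.mul_sum]
    exact Finset.sum_congr rfl fun i _ => abs_mul _ _
  · have hnn : ∀ x, 0 ≤ ∑ i, |gradT Ω (φ u) x i i| := fun x =>
      Finset.sum_nonneg fun _ _ => abs_nonneg _
    refine (integral_nonneg hnn).lt_of_ne fun h0 => hu (hφ ?_)
    rw [map_zero]
    have h1 := (integral_eq_zero_iff_of_nonneg hnn (hdom.integrable u)).1 h0.symm
    refine Subtype.ext (funext fun x => ?_)
    ext i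
    refine congrFun ((hlip u i).eq_zero_of_partial_eq_zero hΩ hb i ?_) x
    filter_upwards [h1] with y hy
    exact abs_eq_zero.1 ((Finset.sum_eq_zero_iff_of_nonneg fun _ _ => abs_nonneg _).1 hy i
      (Finset.mem_univ i))

/-- A discrete Poincaré inequality: the `L¹` norm of a single partial derivative controls the
coordinates of a finite element concentration. -/
theorem exists_poincare_constant (hΩ : IsOpen Ω) (hb : Bornology.IsBounded Ω)
    {ψ : EuclideanSpace ℝ (Fin N) →ₗ[ℝ] concSpace R G} (hψ : Function.Injective ψ) (i : Fin d) :
    ∃ m > 0, ∀ z, m * ‖z‖ ≤ ∫ x in Ω, |weakGrad Ω (ψ z) x i| := by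
  have : IsFiniteMeasure (volume.restrict Ω) := ⟨by simpa using hb.measure_lt_top⟩
  have hdom := (((fieldFamily_of_linearMap hΩ hb ψ continuous_id).grad i).abs).mono_exponent
    (q := 1) le_top
  have hlip : ∀ z, LipZero Ω (ψ z) := fun z => lipZero_of_mem_concSpace hΩ (ψ z).2
  refine exists_pos_mul_norm_le hdom.continuous_integral (fun a z => ?_) fun z hz => ?_
  · refine integral_const_mul_of_ae ?_
    filter_upwards [weakGrad_smul_ae_eq hΩ ⟨_, (hlip z).hasWeakGrad hΩ⟩ a] with x hx
    simp only [map_smul, Submodule.coe_smul, hx]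
    exact abs_mul _ _
  · have hnn : ∀ x, 0 ≤ |weakGrad Ω (ψ z) x i| := fun x => abs_nonneg _
    refine (integral_nonneg hnn).lt_of_ne fun h0 => hz (hψ ?_)
    rw [map_zero]
    have h1 := (integral_eq_zero_iff_of_nonneg hnn (hdom.integrable z)).1 h0.symm
    refine Subtype.ext ((hlip z).eq_zero_of_partial_eq_zero hΩ hb i ?_)
    filter_upwards [h1] with y hy
    exact abs_eq_zero.1 hy

/-- Coercivity of the momentum equation, uniformly in the concentration: the convective term drops
out and the stress power beats the load, because `rm > 1`. -/
theorem exists_momentum_coercivity (hΩ : IsOpen Ω) (hb : Bornology.IsBounded Ω)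
    (h : ConstitutiveLaws Set.univ S q r rm rp) {f : (Vec d → Vec d) → ℝ}
    (hf : IsDualW10Vec p Ω f) {φ : EuclideanSpace ℝ (Fin N) →ₗ[ℝ] velSpace R G}
    (hφ : Function.Injective φ) :
    ∃ c : ℝ, ∀ u (C : Vec d → ℝ), (FieldFamily 1 Ω fun _ : Unit => C) →
      ‖u‖ - c ≤ (∫ x in Ω, tdot (S (C x) (symGrad Ω (φ u) x)) (symGrad Ω (φ u) x))
        + formBu Ω (φ u) (φ u) (φ u) - f (φ u) := by
  have : IsFiniteMeasure (volume.restrict Ω) := ⟨by simpa using hb.measure_lt_top⟩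
  obtain ⟨m, hm, hkorn⟩ := exists_korn_constant hΩ hb hφ
  obtain ⟨fl, hfl⟩ := exists_linearMap_of_isDual hΩ hb hf R G
  set T := LinearMap.toContinuousLinearMap (fl ∘ₗ φ)
  -- `a` is the growth rate of the stress power that beats the load `T` with unit surplus
  set a : ℝ := (1 + ‖T‖) / m
  have ha : 0 ≤ a := by positivity
  obtain ⟨c, hc⟩ := h.exists_stress_linear_lower_bound (a * d)
  refine ⟨c * (volume.restrict Ω).real Set.univ, fun u C hC => ?_⟩
  have hfam : VelFamily Ω fun _ : Unit => (φ u : Vec d → Vec d) :=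
    (vecLipZero_of_mem_velSpace hΩ (φ u).2).velFamily hΩ hb
  have hBu : formBu Ω (φ u) (φ u) (φ u) = 0 := by simp [formBu]
  have hload : f (φ u) ≤ ‖T‖ * ‖u‖ := by
    rw [← hfl]
    exact (le_abs_self _).trans (T.le_opNorm u)
  have hint : Integrable (fun x => ∑ i, |gradT Ω (φ u) x i i|) (volume.restrict Ω) :=
    (DominatedFamily.mono_exponent (p := ∞) (.sum _ fun i _ => (hfam.gradT i i).abs)
      le_top).integrable ()
  have hlow : ∫ x in Ω, (a * ∑ i, |gradT Ω (φ u) x i i| - c) ≤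
      ∫ x in Ω, tdot (S (C x) (symGrad Ω (φ u) x)) (symGrad Ω (φ u) x) := by
    refine integral_mono ((hint.const_mul a).sub (integrable_const c))
      ((VelFamily.stress_work hb h hfam hC hfam).integrable ()) fun x => ?_
    refine le_trans ?_ (hc (C x) _ (isSymm_symGrad _ x))
    have h1 : ∑ i, |gradT Ω (φ u) x i i| ≤ d * tnorm (symGrad Ω (φ u) x) := by
      have h2 : ∀ i ∈ Finset.univ, |gradT Ω (φ u) x i i| ≤ tnorm (symGrad Ω (φ u) x) := by
        intro i _
        have h3 := abs_apply_le_tnorm (symGrad Ω (φ u) x) i i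
        rwa [symGrad_apply, ← two_mul, ← mul_assoc, one_div, inv_mul_cancel₀ two_ne_zero,
          one_mul] at h3
      simpa using Finset.sum_le_card_nsmul _ _ _ h2
    have := mul_le_mul_of_nonneg_left h1 ha
    simp only
    linarith
  rw [integral_sub (hint.const_mul a) (integrable_const c), integral_const_mul, integral_const,
    smul_eq_mul] at hlow
  have h4 := mul_le_mul_of_nonneg_left (hkorn u) ha
  have h5 : a * (m * ‖u‖) = (1 + ‖T‖) * ‖u‖ := by
    rw [← mul_assoc, div_mul_cancel₀ _ hm.ne']
  rw [hBu]
  linarith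

/-- Coercivity of the concentration equation for bounded velocities. The transport form leaves only
terms that are linear in the unknown. -/
theorem exists_concentration_coercivity (hd : 0 < d) (hΩ : IsOpen Ω) (hb : Bornology.IsBounded Ω)
    (h : ConstitutiveLaws Set.univ S q r rm rp) {N' : ℕ}
    (φ : EuclideanSpace ℝ (Fin N') →ₗ[ℝ] velSpace R G)
    {ψ : EuclideanSpace ℝ (Fin N) →ₗ[ℝ] concSpace R G} (hψ : Function.Injective ψ)
    {c : Vec d → ℝ} (hc : FieldFamily 1 Ω fun _ : Unit => c) (M : ℝ) :
    ∃ b : ℝ, ∀ u z, ‖u‖ ≤ M → ‖z‖ - b ≤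
      (∫ x in Ω, inner ℝ (q (((ψ z : Vec d → ℝ) + c) x) (weakGrad Ω ((ψ z : Vec d → ℝ) + c) x)
          (symGrad Ω (φ u) x)) (weakGrad Ω (ψ z) x))
        + formBc Ω ((ψ z : Vec d → ℝ) + c) (φ u) (ψ z) := by
  have : IsFiniteMeasure (volume.restrict Ω) := ⟨by simpa using hb.measure_lt_top⟩
  obtain ⟨m, hm, hpoin⟩ := exists_poincare_constant hΩ hb hψ ⟨0, hd⟩
  obtain ⟨C₄, hC₄, hgrow⟩ := h.flux_growth
  obtain ⟨C₅, hC₅, hcoer⟩ := h.flux_coercive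
  have hψlip : ∀ z, LipZero Ω (ψ z) := fun z => lipZero_of_mem_concSpace hΩ (ψ z).2
  have hψex : ∀ z, ∃ g, HasWeakGrad Ω (ψ z) g := fun z => ⟨_, (hψlip z).hasWeakGrad hΩ⟩
  have hcex : ∃ g, HasWeakGrad Ω c g := hc.exists_grad ()
  have hψfam := fieldFamily_of_linearMap hΩ hb ψ continuous_id
  have hφfam := velFamily_of_linearMap hΩ hb φ continuous_id
  obtain ⟨K₁, hK₁, hval⟩ := hψfam.val.exists_bound_mul_norm fun a z =>
    .of_forall fun x => by simp
  have hgrad : ∀ i, ∃ K : ℝ, 0 ≤ K ∧ ∀ z, ∀ᵐ x ∂volume.restrict Ω,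
      |weakGrad Ω (ψ z) x i| ≤ K * ‖z‖ := fun i =>
    (hψfam.grad i).exists_bound_mul_norm fun a z => by
      filter_upwards [weakGrad_smul_ae_eq hΩ (hψex z) a] with x hx
      simp only [id, map_smul, Submodule.coe_smul, hx]
      rfl
  have hvel : ∀ j, ∃ K : ℝ, 0 ≤ K ∧ ∀ u, ∀ᵐ x ∂volume.restrict Ω,
      |(φ u : Vec d → Vec d) x j| ≤ K * ‖u‖ := fun j =>
    (hφfam j).val.exists_bound_mul_norm fun a u => .of_forall fun x => by simp
  choose K₂ hK₂ hgrad using hgrad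
  choose K₃ hK₃ hvel using hvel
  have hnorm : ∀ v : Vec d, ‖v‖ ≤ ∑ i, |v i| := fun v => by
    rw [EuclideanSpace.norm_eq]
    refine Real.sqrt_le_iff.2 ⟨Finset.sum_nonneg fun _ _ => abs_nonneg _, ?_⟩
    exact Finset.sum_sq_le_sq_sum_of_nonneg fun _ _ => abs_nonneg _
  set K : ℝ := K₁ + ∑ i, K₂ i
  have hKsum : 0 ≤ ∑ i, K₂ i := Finset.sum_nonneg fun i _ => hK₂ i
  set L : ℝ := (∑ j, K₃ j) * |M|
  have hL : 0 ≤ L := mul_nonneg (Finset.sum_nonneg fun j _ => hK₃ j) (abs_nonneg _)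
  -- `‖z‖ * H` bounds the terms that are linear in the unknown: the flux of `∇c` and the transport
  set H : Vec d → ℝ := fun x => C₄ * K * (∑ i, |weakGrad Ω c x i|)
    + 1 / 2 * (K * L * (∑ i, |weakGrad Ω c x i|) + K * L * |c x|)
  have hHint : Integrable H (volume.restrict Ω) := by
    have h1 : Integrable (fun x => ∑ i, |weakGrad Ω c x i|) (volume.restrict Ω) :=
      (DominatedFamily.sum _ fun i _ => (hc.grad i).abs).integrable ()
    have h2 : Integrable (fun x => |c x|) (volume.restrict Ω) := (hc.val.abs).integrable ()
    exact (h1.const_mul _).add (((h1.const_mul _).add (h2.const_mul _)).const_mul _)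
  have hH0 : 0 ≤ ∫ x in Ω, H x := integral_nonneg fun x => by
    have h1 : 0 ≤ ∑ i, |weakGrad Ω c x i| := Finset.sum_nonneg fun _ _ => abs_nonneg _
    have h2 : 0 ≤ K := by positivity
    simp only [H, Pi.zero_apply]
    positivity
  -- `A` is a linear growth rate of the quadratic flux term that beats `H` with unit surplus
  set A : ℝ := (1 + ∫ x in Ω, H x) / m
  have hA : 0 ≤ A := by positivity
  refine ⟨A ^ 2 / (4 * C₅) * (volume.restrict Ω).real Set.univ, fun u z hu => ?_⟩
  have hUf : VelFamily Ω fun _ : Unit => (φ u : Vec d → Vec d) :=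
    (vecLipZero_of_mem_velSpace hΩ (φ u).2).velFamily hΩ hb
  have hZf : FieldFamily ∞ Ω fun _ : Unit => (ψ z : Vec d → ℝ) := .of_lipZero hΩ hb (hψlip z)
  have hCf : FieldFamily 1 Ω fun _ : Unit => (ψ z : Vec d → ℝ) + c :=
    (hZf.mono_exponent hb).add hΩ hc
  have i1 := (FieldFamily.flux_work h hUf hCf hZf).integrable ()
  have i2 := ((FieldFamily.transport_left hUf hCf hZf).sub
    (FieldFamily.transport_right hUf hCf hZf)).integrable ()
  have i3 : Integrable (fun x => |weakGrad Ω (ψ z) x ⟨0, hd⟩|) (volume.restrict Ω) :=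
    (((hZf.grad ⟨0, hd⟩).abs).mono_exponent (q := 1) le_top).integrable ()
  rw [formBc, ← integral_const_mul, ← integral_add i1 (i2.const_mul _)]
  have hlow : ∫ x in Ω, (A * |weakGrad Ω (ψ z) x ⟨0, hd⟩| - A ^ 2 / (4 * C₅) - ‖z‖ * H x) ≤
      ∫ x in Ω, (inner ℝ (q (((ψ z : Vec d → ℝ) + c) x) (weakGrad Ω ((ψ z : Vec d → ℝ) + c) x)
          (symGrad Ω (φ u) x)) (weakGrad Ω (ψ z) x)
        + 1 / 2 * ((ψ z : Vec d → ℝ) x * inner ℝ ((φ u : Vec d → Vec d) x)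
            (weakGrad Ω ((ψ z : Vec d → ℝ) + c) x)
          - ((ψ z : Vec d → ℝ) + c) x * inner ℝ ((φ u : Vec d → Vec d) x)
            (weakGrad Ω (ψ z) x))) := by
    refine integral_mono_ae (((i3.const_mul A).sub (integrable_const _)).sub (hHint.const_mul _))
      (i1.add (i2.const_mul _)) ?_
    filter_upwards [weakGrad_add_ae_eq hΩ (hψex z) hcex, hval z,
      Filter.eventually_all.2 fun i => hgrad i z, Filter.eventually_all.2 fun j => hvel j u]
      with x hx hx1 hx2 hx3
    set s := (ψ z : Vec d → ℝ) x
    set g := weakGrad Ω (ψ z) x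
    set γ := weakGrad Ω c x
    set v := (φ u : Vec d → Vec d) x
    set D := symGrad Ω (φ u) x
    have hD : D.IsSymm := isSymm_symGrad _ x
    simp only [hx, Pi.add_apply]
    rw [(h.flux_linear _ (Set.mem_univ _) D hD).map_add, inner_add_left, inner_add_right]
    have b1 := hcoer (s + c x) (Set.mem_univ _) g D hD
    have b2 : |inner ℝ (q (s + c x) γ D) g| ≤ C₄ * ‖γ‖ * ‖g‖ :=
      (abs_real_inner_le_norm _ _).trans (mul_le_mul_of_nonneg_right
        (hgrow _ (Set.mem_univ _) _ _ hD) (norm_nonneg _))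
    have hs : |s| ≤ K * ‖z‖ := hx1.trans (mul_le_mul_of_nonneg_right (by simp only [K]; linarith)
      (norm_nonneg _))
    have hg : ‖g‖ ≤ K * ‖z‖ := by
      refine (hnorm g).trans ((Finset.sum_le_sum fun i _ => hx2 i).trans ?_)
      rw [← Finset.sum_mul]
      exact mul_le_mul_of_nonneg_right (by simp only [K]; linarith) (norm_nonneg _)
    have hv : ‖v‖ ≤ L := by
      refine (hnorm v).trans ((Finset.sum_le_sum fun j _ => hx3 j).trans ?_)
      rw [← Finset.sum_mul]
      exact mul_le_mul_of_nonneg_left (hu.trans (le_abs_self M))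
        (Finset.sum_nonneg fun j _ => hK₃ j)
    set Γ := ∑ i, |γ i|
    have hΓ : ‖γ‖ ≤ Γ := hnorm γ
    have hKz : 0 ≤ K * ‖z‖ := (abs_nonneg _).trans hs
    have hΓ0 : 0 ≤ Γ := (norm_nonneg _).trans hΓ
    have b3 : C₄ * ‖γ‖ * ‖g‖ ≤ C₄ * Γ * (K * ‖z‖) := by gcongr
    have b4 : |s * inner ℝ v γ| ≤ K * ‖z‖ * (L * Γ) := by
      rw [abs_mul]
      refine mul_le_mul hs ((abs_real_inner_le_norm _ _).trans ?_) (abs_nonneg _) hKz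
      gcongr
    have b5 : |c x * inner ℝ v g| ≤ |c x| * (L * (K * ‖z‖)) := by
      rw [abs_mul]
      refine mul_le_mul_of_nonneg_left ((abs_real_inner_le_norm _ _).trans ?_) (abs_nonneg _)
      gcongr
    have b6 : |g ⟨0, hd⟩| ≤ ‖g‖ := PiLp.norm_apply_le g _
    have b7 : A * |g ⟨0, hd⟩| - A ^ 2 / (4 * C₅) ≤ C₅ * ‖g‖ ^ 2 := by
      have h1 : A * |g ⟨0, hd⟩| ≤ A * ‖g‖ := mul_le_mul_of_nonneg_left b6 hA
      have h2 : C₅ * ‖g‖ ^ 2 - A * ‖g‖ + A ^ 2 / (4 * C₅) = C₅ * (‖g‖ - A / (2 * C₅)) ^ 2 := by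
        field_simp; ring
      have h3 : 0 ≤ C₅ * (‖g‖ - A / (2 * C₅)) ^ 2 := by positivity
      linarith
    have e1 : ‖z‖ * H x = C₄ * Γ * (K * ‖z‖)
        + 1 / 2 * (K * ‖z‖ * (L * Γ) + |c x| * (L * (K * ‖z‖))) := by
      simp only [H]; ring
    have c1 := neg_le_of_abs_le (b2.trans b3)
    have c2 := neg_le_of_abs_le b4
    have c3 := le_of_abs_le b5
    rw [e1]
    -- the terms with `s * ⟪v, g⟫` cancel by the skew symmetry of the transport form
    have e2 : s * (inner ℝ v g + inner ℝ v γ) - (s + c x) * inner ℝ v g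
        = s * inner ℝ v γ - c x * inner ℝ v g := by ring
    rw [e2]
    linarith
  refine le_trans ?_ hlow
  have i4 : Integrable (fun x => A * |weakGrad Ω (ψ z) x ⟨0, hd⟩| - A ^ 2 / (4 * C₅))
      (volume.restrict Ω) := (i3.const_mul A).sub (integrable_const _)
  rw [integral_sub i4 (hHint.const_mul _), integral_sub (i3.const_mul A) (integrable_const _), integral_const_mul, integral_const_mul,
    integral_const, smul_eq_mul]
  have h4 := mul_le_mul_of_nonneg_left (hpoin z) hA
  have h5 : A * (m * ‖z‖) = (1 + ∫ x in Ω, H x) * ‖z‖ := by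
    rw [← mul_assoc, div_mul_cancel₀ _ hm.ne']
  linarith

/-- Existence for the divergence-free problem: in coordinates on the discretely divergence-free
velocities and on the concentrations, the residuals satisfy
`exists_common_zero_of_triangular_coercive`. -/
theorem exists_solvesDivFree (hd : 0 < d) (hΩ : IsOpen Ω) (hb : Bornology.IsBounded Ω)
    (h : ConstitutiveLaws Set.univ S q r rm rp) {f : (Vec d → Vec d) → ℝ}
    (hf : IsDualW10Vec p Ω f) {c_d : Vec d → ℝ} {t : ℝ≥0∞} (ht : 1 ≤ t) (hc : MemW1 t Ω c_d)
    (R : RefSpaces d) (G : Mesh Ω) : ∃ U C, SolvesDivFree R G S q f c_d U C := by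
  obtain ⟨β, hβ⟩ := exists_divergence_pairing hΩ hb R G
  -- coordinates on the discretely divergence-free velocities and on the concentrations
  set K : Submodule ℝ (velSpace R G) := (LinearMap.range β).dualCoannihilator
  have hK : ∀ V : velSpace R G, V ∈ K ↔ (V : Vec d → Vec d) ∈ velDivSpace R G := by
    intro V
    rw [Submodule.mem_dualCoannihilator]
    constructor
    · intro hV
      exact ⟨V.2, fun P hP => by rw [← hβ ⟨P, hP⟩ V]; exact hV _ ⟨_, rfl⟩⟩
    · rintro hV _ ⟨P, rfl⟩
      rw [hβ]
      exact hV.2 P P.2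
  have hfree : Module.Free ℝ K := Module.Free.of_divisionRing ℝ K
  set eK := (WithLp.linearEquiv 2 ℝ (Fin (Module.finrank ℝ K) → ℝ)).trans
    (Module.finBasis ℝ K).equivFun.symm
  set eZ := (WithLp.linearEquiv 2 ℝ (Fin (Module.finrank ℝ (concSpace R G)) → ℝ)).trans
    (Module.finBasis ℝ (concSpace R G)).equivFun.symm
  set φ : EuclideanSpace ℝ (Fin (Module.finrank ℝ K)) →ₗ[ℝ] velSpace R G :=
    K.subtype ∘ₗ eK.toLinearMap
  set ψ : EuclideanSpace ℝ (Fin (Module.finrank ℝ (concSpace R G))) →ₗ[ℝ] concSpace R G :=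
    eZ.toLinearMap
  have hφ : Function.Injective φ := K.injective_subtype.comp eK.injective
  have hφmem : ∀ u, φ u ∈ K := fun u => (eK u).2
  have hφsurj : ∀ V ∈ K, ∃ u, φ u = V := fun V hV => by
    obtain ⟨u, hu⟩ := eK.surjective ⟨V, hV⟩
    exact ⟨u, congrArg Subtype.val hu⟩
  have hψ : Function.Injective ψ := eZ.injective
  have hψsurj : Function.Surjective ψ := eZ.surjective
  have hcd : FieldFamily 1 Ω fun _ : Unit => c_d := FieldFamily.of_memW1 hb ht hc
  have hlip : ∀ u, VecLipZero Ω (φ u) := fun u => vecLipZero_of_mem_velSpace hΩ (φ u).2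
  have hCu : ∀ z, FieldFamily 1 Ω fun _ : Unit => (ψ z : Vec d → ℝ) + c_d := fun z =>
    ((FieldFamily.of_lipZero hΩ hb (lipZero_of_mem_concSpace hΩ (ψ z).2)).mono_exponent hb).add
      hΩ hcd
  choose ℓ hℓ using fun u z => exists_momentum_functional hΩ hb h hf R G (hlip u) (hCu z)
  choose κ hκ using fun u z => exists_concentration_functional hΩ hb h R G (hlip u) (hCu z)
  obtain ⟨c, hc₁⟩ := exists_momentum_coercivity hΩ hb h hf hφ
  have hc₂ := exists_concentration_coercivity hd hΩ hb h φ hψ hcd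
  -- the residual maps depend continuously on the coordinates
  have hUf := velFamily_of_linearMap hΩ hb φ
    (continuous_fst (X := EuclideanSpace ℝ (Fin (Module.finrank ℝ K)))
      (Y := EuclideanSpace ℝ (Fin (Module.finrank ℝ (concSpace R G)))))
  have hCf := ((fieldFamily_of_linearMap hΩ hb ψ
    (continuous_snd (X := EuclideanSpace ℝ (Fin (Module.finrank ℝ K)))
      (Y := EuclideanSpace ℝ (Fin (Module.finrank ℝ (concSpace R G)))))).mono_exponent hb).add hΩ
    (FieldFamily.of_memW1 hb ht hc)
  have hcont₁ : ∀ V : velSpace R G, Continuous fun e :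
      EuclideanSpace ℝ (Fin (Module.finrank ℝ K)) ×
        EuclideanSpace ℝ (Fin (Module.finrank ℝ (concSpace R G))) => ℓ e.1 e.2 V := by
    intro V
    have hVf := (vecLipZero_of_mem_velSpace hΩ V.2).velFamily
      (E := EuclideanSpace ℝ (Fin (Module.finrank ℝ K)) ×
        EuclideanSpace ℝ (Fin (Module.finrank ℝ (concSpace R G)))) hΩ hb
    simp only [hℓ]
    exact ((VelFamily.stress_work hb h hUf hCf hVf).continuous_integral.add
      (((VelFamily.convective hb hUf hVf hUf).sub
        (VelFamily.convective hb hUf hUf hVf)).continuous_integral.const_mul _)).sub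
      continuous_const
  have hcont₂ : ∀ Z : concSpace R G, Continuous fun e :
      EuclideanSpace ℝ (Fin (Module.finrank ℝ K)) ×
        EuclideanSpace ℝ (Fin (Module.finrank ℝ (concSpace R G))) => κ e.1 e.2 Z := by
    intro Z
    have hZf := FieldFamily.of_lipZero
      (E := EuclideanSpace ℝ (Fin (Module.finrank ℝ K)) ×
        EuclideanSpace ℝ (Fin (Module.finrank ℝ (concSpace R G)))) hΩ hb
        (lipZero_of_mem_concSpace hΩ Z.2)
    simp only [hκ]
    exact (FieldFamily.flux_work h hUf hCf hZf).continuous_integral.add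
      (((FieldFamily.transport_left hUf hCf hZf).sub
        (FieldFamily.transport_right hUf hCf hZf)).continuous_integral.const_mul _)
  obtain ⟨u, z, h₁, h₂⟩ := exists_common_zero_of_triangular_coercive
    (F₁ := fun e => WithLp.toLp 2 fun k => (ℓ e.1 e.2 ∘ₗ φ) (EuclideanSpace.single k (1 : ℝ)))
    (F₂ := fun e => WithLp.toLp 2 fun k => (κ e.1 e.2 ∘ₗ ψ) (EuclideanSpace.single k (1 : ℝ)))
    ((PiLp.continuous_toLp 2 _).comp (continuous_pi fun k => hcont₁ _))
    ((PiLp.continuous_toLp 2 _).comp (continuous_pi fun k => hcont₂ _))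
    (c := c) (fun u z => by
      rw [inner_toLp_linearMap, LinearMap.comp_apply, hℓ]
      exact hc₁ u _ (hCu z))
    (fun M => by
      obtain ⟨b, hb'⟩ := hc₂ M
      refine ⟨b, fun u z hu => ?_⟩
      rw [inner_toLp_linearMap, LinearMap.comp_apply, hκ]
      exact hb' u z hu)
  have z₁ : ∀ v, ℓ u z (φ v) = 0 := fun v => by
    rw [← LinearMap.comp_apply, ← inner_toLp_linearMap, h₁, inner_zero_left]
  have z₂ : ∀ y, κ u z (ψ y) = 0 := fun y => by
    rw [← LinearMap.comp_apply, ← inner_toLp_linearMap, h₂, inner_zero_left]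
  refine ⟨φ u, (ψ z : Vec d → ℝ) + c_d, (hK _).1 (hφmem u), by simp, fun V hV => ?_,
    fun Z hZ => ?_⟩
  · obtain ⟨v, hv⟩ := hφsurj ⟨V, hV.1⟩ ((hK _).2 hV)
    have := z₁ v
    rw [hv, hℓ] at this
    exact sub_eq_zero.1 this
  · obtain ⟨y, hy⟩ := hψsurj ⟨Z, hZ⟩
    have := z₂ y
    rw [hy, hκ] at this
    exact this

end Existence

end FiniteElementSystem

theorem mainTheorem7 (d : ℕ) (hd : d = 2 ∨ d = 3)
    (Ω : Set (Vec d)) (hΩ_open : IsOpen Ω) (hΩ_bdd : Bornology.IsBounded Ω)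
    (hΩ_lip : HasLipschitzBoundary Ω)
    (S : ℝ → Ten d → Ten d) (q : ℝ → Vec d → Ten d → Vec d) (r : ℝ → ℝ) (rm rp : ℝ)
    (hlaws : ConstitutiveLaws (Set.Ici 0) S q r rm rp)
    (f : (Vec d → Vec d) → ℝ) (hf : IsDualW10Vec (ENNReal.ofReal rm) Ω f)
    (p : ℝ) (hp : (d : ℝ) < p) (c_d : Vec d → ℝ) (hc_d : MemW1 (ENNReal.ofReal p) Ω c_d)
    (hc_d_nonneg : ∀ᵐ x ∂(MeasureTheory.volume.restrict Ω), 0 ≤ c_d x)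
    (R : RefSpaces d) (G : ℕ → Mesh Ω) (hG : ∀ n, ContainsPiecewiseConst R (G n)) :
    (∀ n, DiscretelySolvable R (G n) (fun ξ => S (max ξ 0)) (fun ξ => q (max ξ 0)) f c_d) ∧
    (ConstitutiveLaws Set.univ S q r rm rp → ∀ n, DiscretelySolvable R (G n) S q f c_d) := by
  have hd0 : 0 < d := by rcases hd with rfl | rfl <;> norm_num
  have hp1 : 1 ≤ ENNReal.ofReal p := by
    have : (1 : ℝ) ≤ d := by exact_mod_cast hd0
    exact ENNReal.one_le_ofReal.2 (this.trans hp.le)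
  have key : ∀ (S' : ℝ → Ten d → Ten d) (q' : ℝ → Vec d → Ten d → Vec d) (r' : ℝ → ℝ),
      ConstitutiveLaws Set.univ S' q' r' rm rp → ∀ n, DiscretelySolvable R (G n) S' q' f c_d :=
    fun S' q' r' h n => ⟨exists_solvesDivFree hd0 hΩ_open hΩ_bdd h hf hp1 hc_d R (G n),
      fun _ _ hUC => hUC.exists_solvesMixed hΩ_open hΩ_bdd h hf hp1 hc_d (hG n)⟩
  exact ⟨key _ _ _ hlaws.comp_max, key S q r⟩
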